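/- For an elliptic curve $E$ over $\mathbf{Q}$ and $n\ge 1$, let $\mathbf{Q}(E[n])\subset\overline{\mathbf{Q}}$ be the field generated over $\mathbf{Q}$ by the coordinates of the $n$-torsion points of $E(\overline{\mathbf{Q}})$. The $(2,3)$-entanglement field of $E$ is the Galois extension $\mathbf{Q}(E[2])\cap\mathbf{Q}(E[3])$ of $\mathbf{Q}$; it is called non-abelian if its Galois group over $\mathbf{Q}$ is non-abelian. Let $E$ be an elliptic curve over $\mathbf{Q}$ without complex multiplication (over $\overline{\mathbf{Q}}$, every endomorphism of $E$ is multiplication by an integer), with $j$-invariant $j_E$. Then the $(2,3)$-entanglement field of $E$ is non-abelian if and only if $j_E$ belongs to one of the following two families: (a) (the Brau–Jones family) $j_E=2^{10}3^3\,t^3(1-4t^3)$ for some $t\in\mathbf{Q}\setminus\{0,\tfrac12\}$; (b) (the $j$-invariants of non-cuspidal rational points on a modular curve of level $6$) there are $s,t\in\mathbf{Q}$ with $t\neq 0$ and $$j_E \;=\; 2^{10}3^3\,s^3(1-4s^3)\;=\;\frac{27(t+1)(t+9)^3}{t^3}.$$ In particular, there are no $j$-invariants outside these two families of non-CM elliptic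 curves over $\mathbf{Q}$ with non-abelian $(2,3)$-entanglement field. -/

import Mathlib

namespace Entanglement

/-- A group endomorphism `φ` of the point group of a Weierstrass curve `W` over an algebraically
closed field `F` is *given by rational functions* if it is zero, or if there are polynomials
`f, g, h` in two variables, with `h` not vanishing identically on `W`, such that
`φ (x, y) = (f (x, y) / h (x, y), g (x, y) / h (x, y))` at every affine point with `h (x, y) ≠ 0`.
On an elliptic curve these are the endomorphisms in the sense of algebraic geometry. -/
def IsRationalEndo {F : Type*} [Field F] [DecidableEq F] (W : WeierstrassCurve.Affine F)
    (φ : W.Point →+ W.Point) : Prop :=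
  φ = 0 ∨ ∃ f g h : Polynomial (Polynomial F),
    (∃ x y : F, W.Nonsingular x y ∧ h.evalEval x y ≠ 0) ∧
    ∀ (x y : F) (hxy : W.Nonsingular x y), h.evalEval x y ≠ 0 →
      ∃ hφ : W.Nonsingular (f.evalEval x y / h.evalEval x y) (g.evalEval x y / h.evalEval x y),
        φ (.some x y hxy) = .some _ _ hφ

open scoped Classical in
/-- The curve `E` has complex multiplication: over the algebraic closure of `K` it has an
endomorphism which is not multiplication by an integer. -/
def HasCM {K : Type*} [Field K] (E : WeierstrassCurve K) : Prop :=
  ∃ φ : ((E.map (algebraMap K (AlgebraicClosure K))).toAffine.Point →+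
      (E.map (algebraMap K (AlgebraicClosure K))).toAffine.Point),
    IsRationalEndo (E.map (algebraMap K (AlgebraicClosure K))).toAffine φ ∧
      ∀ n : ℤ, φ ≠ n • AddMonoidHom.id _

open scoped Classical in
/-- The `n`-division field `K(E[n])`: the subfield of the algebraic closure of `K` generated over
`K` by the coordinates of the affine points of `E` over the algebraic closure killed by `n`. -/
noncomputable def divisionField {K : Type*} [Field K] (E : WeierstrassCurve K) (n : ℕ) :
    IntermediateField K (AlgebraicClosure K) :=
  IntermediateField.adjoin K
    {z | ∃ (x y : AlgebraicClosure K)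
      (hxy : (E.map (algebraMap K (AlgebraicClosure K))).toAffine.Nonsingular x y),
      n • (WeierstrassCurve.Affine.Point.some x y hxy) = 0 ∧ (z = x ∨ z = y)}

/-- The `(m₁, m₂)`-entanglement field `K(E[m₁]) ∩ K(E[m₂])`. -/
noncomputable def entanglementField {K : Type*} [Field K] (E : WeierstrassCurve K) (m₁ m₂ : ℕ) :
    IntermediateField K (AlgebraicClosure K) :=
  divisionField E m₁ ⊓ divisionField E m₂

/-- The curve `E` has a non-abelian `(m₁, m₂)`-entanglement field. For an elliptic curve over a
field of characteristic zero the entanglement field is an intersection of two Galois extensions of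
`K`, hence Galois, so that this says that its Galois group over `K` is not abelian. -/
def HasNonabelianEntanglement {K : Type*} [Field K] (E : WeierstrassCurve K) (m₁ m₂ : ℕ) : Prop :=
  ¬ IsAbelianGalois K (entanglementField E m₁ m₂)

/-- The Brau–Jones family of `j`-invariants. -/
def brauJonesFamily : Set ℚ :=
  {j | ∃ t : ℚ, t ≠ 0 ∧ t ≠ 1 / 2 ∧ j = 2 ^ 10 * 3 ^ 3 * t ^ 3 * (1 - 4 * t ^ 3)}

/-- The `j`-invariants of the non-cuspidal rational points of the level 6 modular curve
`2^10 3^3 s^3 (1 - 4 s^3) = 27 (t + 1) (t + 9)^3 / t^3`. -/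
def borelEntanglementFamily : Set ℚ :=
  {j | ∃ s t : ℚ, t ≠ 0 ∧ j = 2 ^ 10 * 3 ^ 3 * s ^ 3 * (1 - 4 * s ^ 3) ∧
    j = 27 * (t + 1) * (t + 9) ^ 3 / t ^ 3}

end Entanglement

/-! In the coordinate X = 12x + b₂ the 2-torsion abscissae are the roots of f = X³ - 3c₄X - 2c₆,
whose discriminant is Δ up to a square, so ℚ(E[2]) is the splitting field of f. The entanglement
field is a Galois subfield of it, of degree dividing 6. It is non-abelian only in degree 6, which
means that f is irreducible and ℚ(E[2]) ⊆ ℚ(E[3]).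

The quartic for E[3] has a resolvent cubic with roots c₄ - 12δ, δ³ = Δ. Hence ℚ(E[3]) contains the
cube roots of Δ and lies in a tower of square roots over ℚ(δ) (`cubeRoot_mem`, `exists_sqrtTower`).
A cubic with a root in a quadratic extension already has one below (`SqrtTower.exists_root`), so
entanglement yields a root aδ + bδ² of f. Comparing coefficients, c₄ = abΔ and 2c₆ = a³Δ + b³Δ².
Then 1728Δ = c₄³ - c₆² becomes Δw² = -6912 with w = a³ - b³Δ, and t = 12b/w gives the formula for j
(`exists_param_of_root_mem_adjoin_cubeRoot`).

Conversely, t determines such a, b, w (`exists_coeffs_of_param`). All roots of f have the form aδ +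
bδ², so ℚ(E[2]) ⊆ ℚ(E[3]); the discriminant of f is -3 times a square, so the group is S₃ once f is
irreducible. A rational root of f would force Δ to be a cube and give a rational point of x³ + y³ =
2 with x = 2t. Euler's descent leaves only x = 1, that is t = 1/2 (`eq_one_of_add_cube_eq_two`).

The level 6 family has the same shape with parameter s and adds nothing: s = 0 is j = 0, which is
CM, and s = 1/2 is j = 1728, which would make 3 a rational square. -/

namespace Entanglement

/-! ### Eisenstein integers as a Euclidean domain -/

/-- The ring of Eisenstein integers `ℤ[ω]`, `ω² + ω + 1 = 0`. -/
abbrev Eisenstein : Type := QuadraticAlgebra ℤ (-1) (-1)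

namespace Eisenstein

open QuadraticAlgebra

theorem norm_eq (z : Eisenstein) :
    z.norm = z.re ^ 2 - z.re * z.im + z.im ^ 2 := by
  rw [norm_def]; ring

theorem norm_nonneg (z : Eisenstein) : 0 ≤ z.norm := by
  rw [norm_eq]; nlinarith [sq_nonneg (2 * z.re - z.im), sq_nonneg z.im]

theorem norm_eq_zero {z : Eisenstein} : z.norm = 0 ↔ z = 0 := by
  refine ⟨fun h => ?_, fun h => by rw [h, QuadraticAlgebra.norm_zero]⟩
  rw [norm_eq] at h
  have him : z.im = 0 := by
    have : z.im ^ 2 = 0 := by nlinarith [sq_nonneg (2 * z.re - z.im), sq_nonneg z.im]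
    simpa using this
  have hre : z.re = 0 := by
    rw [him] at h
    have : z.re ^ 2 = 0 := by linarith
    simpa using this
  ext <;> simp [him, hre]

theorem norm_pos {z : Eisenstein} (hz : z ≠ 0) : 0 < z.norm :=
  lt_of_le_of_ne (norm_nonneg z) fun h => hz (norm_eq_zero.1 h.symm)

/-- The nearest integer to `u / n`. -/
def nearest (u n : ℤ) : ℤ := (2 * u + n) / (2 * n)

theorem abs_sub_nearest {u n : ℤ} (hn : 0 < n) :
    -n ≤ 2 * (u - n * nearest u n) ∧ 2 * (u - n * nearest u n) ≤ n := by
  have h1 := Int.mul_ediv_add_emod (2 * u + n) (2 * n)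
  have h2 := Int.emod_nonneg (2 * u + n) (show 2 * n ≠ 0 by positivity)
  have h3 := Int.emod_lt_of_pos (2 * u + n) (show 0 < 2 * n by positivity)
  unfold nearest
  constructor <;> nlinarith

/-- The quotient of a division with remainder. -/
def quot (a b : Eisenstein) : Eisenstein :=
  ⟨nearest (a * star b).re b.norm, nearest (a * star b).im b.norm⟩

/-- Rounding leaves an error with both coordinates at most 1/2 in absolute value, and there u² - uv
+ v² ≤ 3/4. -/
theorem norm_sub_mul_quot_lt (a : Eisenstein) {b : Eisenstein} (hb : b ≠ 0) :
    (a - b * quot a b).norm < b.norm := by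
  have hn := norm_pos hb
  have hu := abs_sub_nearest (u := (a * star b).re) hn
  have hv := abs_sub_nearest (u := (a * star b).im) hn
  have key : (a - b * quot a b).norm * b.norm =
      ((a * star b).re - b.norm * nearest (a * star b).re b.norm) ^ 2
      - ((a * star b).re - b.norm * nearest (a * star b).re b.norm)
        * ((a * star b).im - b.norm * nearest (a * star b).im b.norm)
      + ((a * star b).im - b.norm * nearest (a * star b).im b.norm) ^ 2 := by
    rw [← norm_star b, ← map_mul, norm_star b]
    have : (a - b * quot a b) * star b = ⟨(a * star b).re - b.norm * (quot a b).re,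
        (a * star b).im - b.norm * (quot a b).im⟩ := by
      rw [norm_def]
      ext <;> simp [re_star, im_star] <;> ring
    rw [this, norm_eq]
    rfl
  set p := (a * star b).re - b.norm * nearest (a * star b).re b.norm
  set q := (a * star b).im - b.norm * nearest (a * star b).im b.norm
  set n := b.norm
  have h4 : 4 * (p ^ 2 - p * q + q ^ 2) ≤ 3 * n ^ 2 := by
    nlinarith [mul_nonneg (sub_nonneg.2 hu.2) (neg_le_iff_add_nonneg.1 hu.1),
      mul_nonneg (sub_nonneg.2 hv.2) (neg_le_iff_add_nonneg.1 hv.1),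
      mul_nonneg (neg_le_iff_add_nonneg.1 hu.1) (neg_le_iff_add_nonneg.1 hv.1),
      mul_nonneg (sub_nonneg.2 hu.2) (sub_nonneg.2 hv.2)]
  nlinarith

noncomputable instance : IsDomain Eisenstein :=
  have : NoZeroDivisors Eisenstein := ⟨fun {a b} h => by
    have := congrArg QuadraticAlgebra.norm h
    rw [map_mul, QuadraticAlgebra.norm_zero, mul_eq_zero, norm_eq_zero, norm_eq_zero] at this
    exact this⟩
  NoZeroDivisors.to_isDomain _

noncomputable instance : EuclideanDomain Eisenstein where
  quotient a b := if b = 0 then 0 else quot a b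
  quotient_zero a := by simp
  remainder a b := a - b * (if b = 0 then 0 else quot a b)
  quotient_mul_add_remainder_eq a b := by ring
  r a b := a.norm.natAbs < b.norm.natAbs
  r_wellFounded := (measure fun a : Eisenstein => a.norm.natAbs).wf
  remainder_lt a b hb := by
    rw [if_neg hb]
    exact Int.natAbs_lt_natAbs_of_nonneg_of_lt (norm_nonneg _) (norm_sub_mul_quot_lt a hb)
  mul_left_not_lt a b hb := by
    rw [map_mul, Int.natAbs_mul, not_lt]
    exact Nat.le_mul_of_pos_right _ (Int.natAbs_pos.2 (norm_pos hb).ne')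

/-- Multiplication by ω does not change the cube, and one of d, ωd, ω²d has even ω-coordinate. As 1
+ 2ω = √-3, that one is a + b√-3. -/
theorem exists_even_im_cube (d : Eisenstein) :
    ∃ a b : ℤ, (⟨a + b, 2 * b⟩ : Eisenstein) ^ 3 = d ^ 3 := by
  have key (x y : ℤ) : (⟨-y, x - y⟩ : Eisenstein) ^ 3 = ⟨x, y⟩ ^ 3 := by
    simp only [pow_succ, pow_zero, one_mul]
    ext <;> simp <;> ring
  obtain ⟨x, y⟩ := d
  rcases Int.even_or_odd' y with ⟨k, rfl | rfl⟩
  · exact ⟨x - k, k, by rw [sub_add_cancel]⟩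
  rcases Int.even_or_odd' x with ⟨m, rfl | rfl⟩
  · refine ⟨2 * k + 1 - m, -m, ?_⟩
    rw [← key (2 * m), ← key (-(2 * k + 1))]
    congr 2 <;> ring
  · refine ⟨-(2 * k + 1) - (m - k), m - k, ?_⟩
    rw [← key (2 * m + 1)]
    congr 2 <;> ring

end Eisenstein

/-! ### Euler's descent for x³ + y³ = 2 -/

open QuadraticAlgebra Eisenstein in
/-- Euler's lemma on cubes of the form `p² + 3q²`. -/
theorem exists_of_sq_add_three_mul_sq_eq_cube {p q r : ℤ} (hpq : IsCoprime p q)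
    (hodd : Odd (p + q)) (h3 : ¬ (3 : ℤ) ∣ p) (h : p ^ 2 + 3 * q ^ 2 = r ^ 3) :
    ∃ a b : ℤ, p = a * (a ^ 2 - 9 * b ^ 2) ∧ q = 3 * b * (a ^ 2 - b ^ 2) := by
  -- This is p + q√-3, so its norm is p² + 3q² = r³.
  set α : Eisenstein := ⟨p + q, 2 * q⟩ with hα
  have hN : α * star α = ((r ^ 3 : ℤ) : Eisenstein) := by
    rw [← h]
    ext
    · rw [re_intCast, Int.cast_id]
      simp only [hα, re_mul, star_mk]
      ring
    · rw [im_intCast]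
      simp only [hα, im_mul, star_mk]
      ring
  have hsum : α + star α = ((2 * p : ℤ) : Eisenstein) := by
    ext
    · rw [re_intCast, Int.cast_id]
      simp only [hα, re_add, star_mk]
      ring
    · rw [im_intCast]
      simp only [hα, im_add, star_mk]
      ring
  -- A common divisor of α and its conjugate divides both their sum 2p and their product r³.
  have h2 : IsCoprime (2 * p) (r ^ 3) := by
    rw [← h, IsCoprime.mul_left_iff]
    constructor
    · rw [Int.prime_two.coprime_iff_not_dvd, ← even_iff_two_dvd, Int.not_even_iff_odd]
      rcases Int.even_or_odd p with hp | hp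
      · have hq : Odd q := by rwa [Int.odd_add', iff_true_right hp] at hodd
        exact (hp.pow_of_ne_zero two_ne_zero).add_odd ((by decide : Odd (3 : ℤ)).mul hq.pow)
      · have hq : Even q := by rwa [Int.odd_add, iff_true_left hp] at hodd
        exact hp.pow.add_even ((hq.pow_of_ne_zero two_ne_zero).mul_left 3)
    · have : IsCoprime p (3 * q ^ 2) :=
        IsCoprime.mul_right ((Int.prime_three.coprime_iff_not_dvd.2 h3).symm) hpq.pow_right
      have := this.add_mul_left_right p
      rwa [add_comm, ← sq] at this
  have hcop : IsCoprime α (star α) := by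
    obtain ⟨u, v, huv⟩ := h2
    refine ⟨u + v * star α, u, ?_⟩
    have := congrArg (Int.cast : ℤ → Eisenstein) huv
    rw [Int.cast_add, Int.cast_mul u, Int.cast_mul v, ← hN, ← hsum, Int.cast_one] at this
    rw [← this]
    ring
  rw [Int.cast_pow] at hN
  obtain ⟨d, ε, hε⟩ := exists_associated_pow_of_mul_eq_pow' hcop hN
  obtain ⟨a, b, hab⟩ := exists_even_im_cube d
  have hcube : (⟨a + b, 2 * b⟩ : Eisenstein) ^ 3 =
      ⟨a * (a ^ 2 - 9 * b ^ 2) + 3 * b * (a ^ 2 - b ^ 2), 2 * (3 * b * (a ^ 2 - b ^ 2))⟩ := by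
    simp only [pow_succ, pow_zero, one_mul]
    ext <;> simp <;> ring
  rw [← hab, hcube] at hε
  set A := a * (a ^ 2 - 9 * b ^ 2)
  set B := 3 * b * (a ^ 2 - b ^ 2)
  have hre := congrArg QuadraticAlgebra.re hε
  have him := congrArg QuadraticAlgebra.im hε
  have hnorm : (ε : Eisenstein).norm = 1 := by
    have := (isUnit_iff_norm_isUnit.1 ε.isUnit)
    rcases Int.isUnit_iff.1 this with h1 | h1
    · exact h1
    · have := norm_nonneg (ε : Eisenstein)
      omega
  rw [norm_eq] at hnorm
  simp only [re_mul, im_mul, hα] at hre him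
  set e := (ε : Eisenstein).re
  set f := (ε : Eisenstein).im
  -- The unit ε = e + fω is ±1: odd f would make A + B, hence p + q, even. For f = 2k the norm is (e
  -- - k)² + 3k² = 1, so k = 0.
  have hf : f = 0 := by
    have hf2 : Even f := by
      by_contra hf
      rw [Int.not_even_iff_odd] at hf
      have hAB : Even (A + B) := by
        have : Even ((A + B) * f) := ⟨q - B * e + B * f, by linarith⟩
        exact (Int.even_mul.1 this).resolve_right (Int.not_even_iff_odd.2 hf)
      have : Even (p + q) := by
        rw [← hre]
        exact (hAB.mul_right e).add ⟨-1 * (B * f), by ring⟩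
      exact Int.not_even_iff_odd.2 hodd this
    obtain ⟨k, hk⟩ := hf2
    have : k ^ 2 < 1 := by
      rw [hk] at hnorm
      nlinarith [sq_nonneg (e - k)]
    have : k = 0 := by
      have : k ^ 2 = 0 := by nlinarith [sq_nonneg k]
      simpa using this
    omega
  rw [hf] at hre him hnorm
  have he : e = 1 ∨ e = -1 := by
    rw [← sq_eq_one_iff]
    linarith
  rcases he with he | he <;> rw [he] at hre him
  · exact ⟨a, b, by linarith, by linarith⟩
  · refine ⟨-a, -b, ?_, ?_⟩
    · rw [show -a * ((-a) ^ 2 - 9 * (-b) ^ 2) = -A by ring]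
      linarith
    · rw [show 3 * -b * ((-a) ^ 2 - (-b) ^ 2) = -B by ring]
      linarith

theorem isCoprime_of_odd_add {a b : ℤ} (hab : IsCoprime a b) (hodd : Odd (a + b)) :
    IsCoprime (a - b) (a + b) := by
  have h2 : IsCoprime 2 (a + b) := by
    rwa [Int.prime_two.coprime_iff_not_dvd, ← even_iff_two_dvd, Int.not_even_iff_odd]
  have h : IsCoprime (a + b) (2 * a) :=
    IsCoprime.mul_right h2.symm (by simpa [add_comm] using (hab.symm.add_mul_left_left 1))
  have := h.add_mul_left_right (-1)
  rw [show 2 * a + (a + b) * -1 = a - b by ring] at this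
  exact this.symm

theorem exists_cubes_of_mul_sub_mul_add {c d k : ℤ} (hcd : IsCoprime c d) (hodd : Odd (c + d))
    (h : c * ((c - d) * (c + d)) = k ^ 3) :
    ∃ t u v : ℤ, c = t ^ 3 ∧ c - d = u ^ 3 ∧ c + d = v ^ 3 := by
  have h1 : IsCoprime c (c - d) := by
    have := (hcd.neg_right).add_mul_left_right 1
    rwa [mul_one, neg_add_eq_sub] at this
  have h2 : IsCoprime c (c + d) := by
    have := hcd.add_mul_left_right 1
    rwa [mul_one, add_comm] at this
  have h3 := isCoprime_of_odd_add hcd hodd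
  obtain ⟨t, ht⟩ := Int.eq_pow_of_mul_eq_pow_odd_left (h1.mul_right h2) (by decide) h
  obtain ⟨w, hw⟩ := Int.eq_pow_of_mul_eq_pow_odd_right (h1.mul_right h2) (by decide) h
  obtain ⟨u, hu⟩ := Int.eq_pow_of_mul_eq_pow_odd_left h3 (by decide) hw
  obtain ⟨v, hv⟩ := Int.eq_pow_of_mul_eq_pow_odd_right h3 (by decide) hw
  exact ⟨t, u, v, ht, hu, hv⟩

theorem natAbs_lt_of_cube {t z c : ℤ} (h : t ^ 3 ∣ c) (hc : c ≠ 0) (hlt : c.natAbs < z.natAbs ^ 3) :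
    t.natAbs < z.natAbs := by
  have h1 := Int.natAbs_dvd_natAbs.2 h
  rw [Int.natAbs_pow] at h1
  have h2 := Nat.le_of_dvd (Int.natAbs_pos.2 hc) h1
  exact lt_of_pow_lt_pow_left₀ 3 (Nat.zero_le _) (h2.trans_lt hlt)

/-- This is x³ + y³ = 2z³ in the variables x = p + q, y = p - q. Infinite descent on |z|: by Euler's
lemma a solution yields three pairwise coprime cubes c, c - d, c + d in arithmetic progression, and
these form a smaller solution. -/
theorem mul_sq_add_three_mul_sq_ne_cube (n : ℕ) : ∀ {p q z : ℤ}, z.natAbs = n →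
    IsCoprime p q → Odd (p + q) → p ≠ 0 → q ≠ 0 → p * (p ^ 2 + 3 * q ^ 2) ≠ z ^ 3 := by
  induction n using Nat.strong_induction_on with
  | _ n ih =>
  intro p q z hn hpq hodd hp hq h
  -- With c = t³ and c ∓ d = u³, v³, one has u³ + v³ = 2t³. The half-sum m and half-difference l of
  -- v and u satisfy m(m² + 3l²) = t³, and |t| < |z| because t³ = c.
  have descend (c d : ℤ) (k : ℤ) (hcd : IsCoprime c d) (hcdo : Odd (c + d)) (hc : c ≠ 0)
      (hd : d ≠ 0) (hk : c * ((c - d) * (c + d)) = k ^ 3) (hlt : c.natAbs < z.natAbs ^ 3) :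
      False := by
    obtain ⟨t, u, v, rfl, hu, hv⟩ := exists_cubes_of_mul_sub_mul_add hcd hcdo hk
    have hlt := natAbs_lt_of_cube dvd_rfl hc hlt
    have huo : Odd u := by
      have : Odd (u ^ 3) := by
        rw [← hu, ← Int.not_even_iff_odd, Int.even_sub, ← Int.even_add, Int.not_even_iff_odd]
        exact hcdo
      exact Int.odd_pow' (by decide) |>.1 this
    have hvo : Odd v := by
      have : Odd (v ^ 3) := by rwa [← hv]
      exact Int.odd_pow' (by decide) |>.1 this
    obtain ⟨m, hm⟩ := hvo.add_odd huo
    obtain ⟨l, hl⟩ := hvo.sub_odd huo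
    have huv : IsCoprime u v := by
      have := isCoprime_of_odd_add hcd hcdo
      rw [hu, hv] at this
      exact (IsCoprime.pow_iff (by decide) (by decide)).1 this
    obtain rfl : v = m + l := by omega
    obtain rfl : u = m - l := by omega
    have hml : m * (m ^ 2 + 3 * l ^ 2) = t ^ 3 := by linarith
    refine ih t.natAbs (hn ▸ hlt) (p := m) (q := l) rfl ?_ hvo ?_ ?_ hml
    · obtain ⟨x, y, hxy⟩ := huv
      exact ⟨x + y, y - x, by linarith⟩
    · rintro rfl
      exact hc (by rw [← hml]; ring)
    · rintro rfl
      apply hd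
      linarith
  have hz : z ≠ 0 := by
    rintro rfl
    have : p ^ 2 + 3 * q ^ 2 ≠ 0 := by positivity
    simp [hp, this] at h
  have hsq (x : ℤ) (hx : x ≠ 0) : 1 ≤ x ^ 2 := by
    have : 0 < x ^ 2 := by positivity
    omega
  have hzabs : z.natAbs ^ 3 = p.natAbs * (p ^ 2 + 3 * q ^ 2).natAbs := by
    rw [← Int.natAbs_pow, ← h, Int.natAbs_mul]
  have hplt : p.natAbs < z.natAbs ^ 3 := by
    rw [hzabs]
    have : 4 ≤ (p ^ 2 + 3 * q ^ 2).natAbs := by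
      have := hsq p hp
      have := hsq q hq
      omega
    have := Int.natAbs_pos.2 hp
    nlinarith
  -- If 3 ∣ p, then p = 9l, z = 3m and l(q² + 27l²) = m³, so Euler's lemma applies to (q, 3l)
  -- instead of (p, q).
  by_cases h3 : (3 : ℤ) ∣ p
  · obtain ⟨k, rfl⟩ := h3
    have h3q : ¬ (3 : ℤ) ∣ q := fun hq3 =>
      Int.prime_three.not_isUnit (hpq.isUnit_of_dvd' (dvd_mul_right 3 k) hq3)
    have h3z : (3 : ℤ) ∣ z := Int.prime_three.dvd_of_dvd_pow (n := 3) ⟨k * ((3 * k) ^ 2 + 3 * q ^ 2), by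
      rw [← h]; ring⟩
    obtain ⟨m, rfl⟩ := h3z
    have hk : k * (3 * k ^ 2 + q ^ 2) = 3 * m ^ 3 := by linarith
    have h3k : (3 : ℤ) ∣ k := by
      have : (3 : ℤ) ∣ k * (3 * k ^ 2 + q ^ 2) := ⟨_, hk⟩
      refine (Int.prime_three.dvd_or_dvd this).resolve_right fun h' => h3q ?_
      exact Int.prime_three.dvd_of_dvd_pow ((dvd_add_right (dvd_mul_right 3 _)).1 h')
    obtain ⟨l, rfl⟩ := h3k
    have hl : l * (q ^ 2 + 3 * (3 * l) ^ 2) = m ^ 3 := by linarith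
    have hql : IsCoprime q (3 * l) := hpq.symm.of_mul_right_right
    have hlq : IsCoprime l (q ^ 2 + 3 * (3 * l) ^ 2) := by
      have := (hql.of_mul_right_right.symm.pow_right (n := 2)).add_mul_left_right (27 * l)
      rwa [show q ^ 2 + l * (27 * l) = q ^ 2 + 3 * (3 * l) ^ 2 by ring] at this
    obtain ⟨c, hc⟩ := Int.eq_pow_of_mul_eq_pow_odd_left hlq (by decide) hl
    obtain ⟨r, hr⟩ := Int.eq_pow_of_mul_eq_pow_odd_right hlq (by decide) hl
    have hodd' : Odd (q + 3 * l) := by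
      have : q + 3 * l = 3 * (3 * l) + q - 2 * (3 * l) := by ring
      rw [this]
      exact hodd.sub_even (even_two_mul _)
    obtain ⟨a, b, hqa, hlb⟩ := exists_of_sq_add_three_mul_sq_eq_cube hql hodd' h3q hr
    have hlb : l = b * (a ^ 2 - b ^ 2) := by linarith
    have hl0 : l ≠ 0 := by rintro rfl; simp at hp
    have hb0 : b ≠ 0 := by rintro rfl; simp [hlb] at hl0
    have ha0 : a ≠ 0 := by rintro rfl; simp [hqa] at hq
    refine descend b a (-c) ?_ ?_ hb0 ha0 (by rw [neg_pow, ← hc, hlb]; ring) ?_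
    · have := hql.of_mul_right_right
      rw [hqa, hlb] at this
      exact this.of_mul_left_left.of_mul_right_left.symm
    · by_contra hev
      rw [Int.not_odd_iff_even] at hev
      refine Int.not_even_iff_odd.2 hodd' ?_
      have : q + 3 * l = (b + a) * (a ^ 2 + 2 * a * b - 11 * b ^ 2) + 2 * (4 * b ^ 3) := by
        rw [hqa, hlb]; ring
      rw [this]
      exact (hev.mul_right _).add (even_two_mul _)
    · refine lt_of_le_of_lt (Nat.le_of_dvd (Int.natAbs_pos.2 hp) (Int.natAbs_dvd_natAbs.2 ?_)) hplt
      exact ⟨9 * (a ^ 2 - b ^ 2), by rw [hlb]; ring⟩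
  · have hpq' : IsCoprime p (p ^ 2 + 3 * q ^ 2) := by
      have : IsCoprime p (3 * q ^ 2) :=
        IsCoprime.mul_right ((Int.prime_three.coprime_iff_not_dvd.2 h3).symm) hpq.pow_right
      have := this.add_mul_left_right p
      rwa [add_comm, ← sq] at this
    obtain ⟨c, hc⟩ := Int.eq_pow_of_mul_eq_pow_odd_left hpq' (by decide) h
    obtain ⟨r, hr⟩ := Int.eq_pow_of_mul_eq_pow_odd_right hpq' (by decide) h
    obtain ⟨a, b, hpa, hqb⟩ := exists_of_sq_add_three_mul_sq_eq_cube hpq hodd h3 hr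
    have hb0 : b ≠ 0 := by rintro rfl; simp [hqb] at hq
    have ha0 : a ≠ 0 := by rintro rfl; simp [hpa] at hp
    refine descend a (3 * b) c ?_ ?_ ha0 (by simpa using hb0) (by rw [← hc, hpa]; ring) ?_
    · refine IsCoprime.mul_right ?_ ?_
      · refine (Int.prime_three.coprime_iff_not_dvd.2 fun h => h3 ?_).symm
        rw [hpa]
        exact h.mul_right _
      · rw [hpa, hqb] at hpq
        exact hpq.of_mul_left_left.of_mul_right_left.of_mul_right_right
    · by_contra hev
      rw [Int.not_odd_iff_even] at hev
      refine Int.not_even_iff_odd.2 hodd ?_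
      have : p + q = (a + 3 * b) * (a ^ 2 - 9 * b ^ 2) + 2 * (12 * b ^ 3) := by rw [hpa, hqb]; ring
      rw [this]
      exact (hev.mul_right _).add (even_two_mul _)
    · refine lt_of_le_of_lt (Nat.le_of_dvd (Int.natAbs_pos.2 hp) (Int.natAbs_dvd_natAbs.2 ?_)) hplt
      exact ⟨_, hpa⟩

theorem eq_of_add_cube_eq_two_mul_cube {x y n : ℤ} (hxn : IsCoprime x n) (hn : n ≠ 0)
    (h : x ^ 3 + y ^ 3 = 2 * n ^ 3) : x = y := by
  by_contra hne
  have hxy : IsCoprime x y := by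
    rw [Int.isCoprime_iff_gcd_eq_one]
    have h1 : ((Int.gcd x y : ℤ)) ^ 3 ∣ 2 * n ^ 3 := by
      rw [← h]
      exact dvd_add (pow_dvd_pow_of_dvd (Int.gcd_dvd_left ..) 3)
        (pow_dvd_pow_of_dvd (Int.gcd_dvd_right ..) 3)
    have h2 : IsCoprime ((Int.gcd x y : ℤ) ^ 3) (n ^ 3) :=
      (hxn.of_isCoprime_of_dvd_left (Int.gcd_dvd_left ..)).pow
    have h3 : Int.gcd x y ^ 3 ∣ 2 := by exact_mod_cast h2.dvd_of_dvd_mul_right h1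
    have h4 := Nat.le_of_dvd two_pos h3
    have h5 : Int.gcd x y < 2 := by
      by_contra! h6
      have := Nat.pow_le_pow_left h6 3
      omega
    have h6 : Int.gcd x y ≠ 0 := by
      intro h0
      rw [h0] at h3
      norm_num at h3
    omega
  have hpar : Even x ↔ Even y := by
    have : Even (x ^ 3 + y ^ 3) := by rw [h]; exact even_two_mul _
    rwa [Int.even_add, Int.even_pow' three_ne_zero, Int.even_pow' three_ne_zero] at this
  have hx : Odd x := by
    by_contra hx
    rw [Int.not_odd_iff_even] at hx
    exact Int.prime_two.not_isUnit
      (hxy.isUnit_of_dvd' hx.two_dvd (hpar.1 hx).two_dvd)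
  have hy : Odd y := by rwa [← Int.not_even_iff_odd, ← hpar, Int.not_even_iff_odd]
  obtain ⟨p, hp⟩ := hx.add_odd hy
  obtain ⟨q, hq⟩ := hx.sub_odd hy
  obtain rfl : x = p + q := by omega
  obtain rfl : y = p - q := by omega
  refine mul_sq_add_three_mul_sq_ne_cube n.natAbs (p := p) (q := q) (z := n) rfl ?_ hx ?_ ?_
    (by linarith)
  · obtain ⟨u, v, huv⟩ := hxy
    exact ⟨u + v, u - v, by linarith⟩
  · rintro rfl
    have : n ^ 3 = 0 := by linarith
    exact hn (by simpa using this)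
  · rintro rfl
    simp at hne

/-- The only rational point of `x³ + y³ = 2` is `(1, 1)`. -/
theorem eq_one_of_add_cube_eq_two {x y : ℚ} (h : x ^ 3 + y ^ 3 = 2) : x = 1 := by
  have hden : x.den = y.den := by
    have h1 : (x ^ 3).den = (y ^ 3).den := by
      have : x ^ 3 = ((2 : ℤ) : ℚ) - y ^ 3 := by push_cast; linarith
      rw [this, Rat.intCast_sub_den]
    rw [Rat.den_pow, Rat.den_pow] at h1
    exact Nat.pow_left_injective three_ne_zero h1
  have hx := x.num_div_den
  have hy := y.num_div_den
  rw [← hden] at hy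
  have hd : (x.den : ℚ) ≠ 0 := by exact_mod_cast x.den_nz
  have hint : x.num ^ 3 + y.num ^ 3 = 2 * (x.den : ℤ) ^ 3 := by
    rw [← hx, ← hy] at h
    field_simp at h
    rw [mul_comm 2]
    exact_mod_cast h
  have hxy : x.num = y.num := eq_of_add_cube_eq_two_mul_cube
    (Int.isCoprime_iff_nat_coprime.2 (by simpa using x.reduced)) (by exact_mod_cast x.den_nz) hint
  have : x = y := by rw [← hx, ← hy, hxy]
  rw [← this] at h
  have h1 : (x - 1) * (x ^ 2 + x + 1) = 0 := by linarith
  rcases mul_eq_zero.1 h1 with h2 | h2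
  · linarith
  · nlinarith [sq_nonneg (2 * x + 1)]

/-! ### Points of order two and three -/

section Torsion

variable {F : Type*} [Field F] (W : WeierstrassCurve.Affine F)

open WeierstrassCurve.Affine

/-- The value of the third division polynomial at a point of a Weierstrass curve. -/
theorem psi_three_eq {x y : F} (h : W.Equation x y) :
    3 * x ^ 4 + W.b₂ * x ^ 3 + 3 * W.b₄ * x ^ 2 + 3 * W.b₆ * x + W.b₈ =
      (W.a₂ + 3 * x) * (2 * y + W.a₁ * x + W.a₃) ^ 2
      - W.a₁ * (3 * x ^ 2 + 2 * W.a₂ * x + W.a₄ - W.a₁ * y) * (2 * y + W.a₁ * x + W.a₃)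
      - (3 * x ^ 2 + 2 * W.a₂ * x + W.a₄ - W.a₁ * y) ^ 2 := by
  rw [equation_iff] at h
  simp only [WeierstrassCurve.b₂, WeierstrassCurve.b₄, WeierstrassCurve.b₆, WeierstrassCurve.b₈]
  linear_combination -(12 * x + W.a₁ ^ 2 + 4 * W.a₂) * h

variable [DecidableEq F]

theorem two_nsmul_some_eq_zero_iff {x y : F} (h : W.Nonsingular x y) :
    2 • (Point.some x y h) = 0 ↔ 2 * y + W.a₁ * x + W.a₃ = 0 := by
  rw [two_nsmul]
  have hiff : y = W.negY x y ↔ 2 * y + W.a₁ * x + W.a₃ = 0 := by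
    rw [negY]
    exact ⟨fun h => by linear_combination h, fun h => by linear_combination h⟩
  rw [← hiff]
  refine ⟨fun h0 => ?_, fun hy => Point.add_self_of_Y_eq hy⟩
  by_contra hy
  rw [Point.add_self_of_Y_ne hy] at h0
  exact Point.some_ne_zero _ h0

/-- 3P = 0 means 2P = -P. Away from 2-torsion this says x(2P) = x(P), since the alternative 2P = P
is excluded. At a 2-torsion point both sides fail: a zero of the polynomial would make both partial
derivatives vanish. -/
theorem three_nsmul_some_eq_zero_iff {x y : F} (h : W.Nonsingular x y) :
    3 • (Point.some x y h) = 0 ↔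
      3 * x ^ 4 + W.b₂ * x ^ 3 + 3 * W.b₄ * x ^ 2 + 3 * W.b₆ * x + W.b₈ = 0 := by
  have h3 : 3 • (Point.some x y h) = 0 ↔
      Point.some x y h + Point.some x y h = -Point.some x y h := by
    rw [succ_nsmul, two_nsmul, add_eq_zero_iff_eq_neg]
  rw [h3, psi_three_eq W h.1]
  by_cases hy : y = W.negY x y
  · have hη : 2 * y + W.a₁ * x + W.a₃ = 0 := by
      rw [negY] at hy
      linear_combination hy
    rw [Point.add_self_of_Y_eq hy, Point.neg_some, hη]
    refine iff_of_false (fun h0 => Point.some_ne_zero _ h0.symm) fun h0 => ?_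
    have h1 : 3 * x ^ 2 + 2 * W.a₂ * x + W.a₄ - W.a₁ * y = 0 := by
      have : (3 * x ^ 2 + 2 * W.a₂ * x + W.a₄ - W.a₁ * y) ^ 2 = 0 := by linear_combination -h0
      simpa using this
    rcases (W.nonsingular_iff x y).1 h with ⟨-, h2 | h2⟩
    · exact h2 (by linear_combination -h1)
    · exact h2 (by linear_combination hη)
  · have hη : 2 * y + W.a₁ * x + W.a₃ ≠ 0 := fun h0 => hy (by
      rw [negY]
      linear_combination h0)
    have hslope : W.slope x x y y * (2 * y + W.a₁ * x + W.a₃) =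
        3 * x ^ 2 + 2 * W.a₂ * x + W.a₄ - W.a₁ * y := by
      rw [slope_of_Y_ne rfl hy, negY, show y - (-y - W.a₁ * x - W.a₃) = 2 * y + W.a₁ * x + W.a₃ by ring,
        div_mul_cancel₀ _ hη]
    have hX : W.addX x x (W.slope x x y y) = x ↔ (W.a₂ + 3 * x) * (2 * y + W.a₁ * x + W.a₃) ^ 2
      - W.a₁ * (3 * x ^ 2 + 2 * W.a₂ * x + W.a₄ - W.a₁ * y) * (2 * y + W.a₁ * x + W.a₃)
      - (3 * x ^ 2 + 2 * W.a₂ * x + W.a₄ - W.a₁ * y) ^ 2 = 0 := by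
      rw [← hslope, addX, ← sub_eq_zero,
        ← mul_right_inj' (neg_ne_zero.2 (pow_ne_zero 2 hη)), mul_zero]
      ring_nf
    rw [← hX, Point.add_self_of_Y_ne hy]
    constructor
    · intro h0
      rw [Point.neg_some, Point.some.injEq] at h0
      exact h0.1
    · intro h0
      rcases (Point.X_eq_iff (h₂ := h)).1 h0 with h1 | h1
      · rw [← Point.add_self_of_Y_ne (h₁ := h) hy, add_eq_left] at h1
        exact absurd h1 (Point.some_ne_zero h)
      · exact h1

end Torsion

/-! ### The automorphism of order three when c₄ = 0 -/

section ComplexMultiplication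

open WeierstrassCurve.Affine

variable {F : Type*} [Field F] [CharZero F] (W : WeierstrassCurve.Affine F) {ω : F}

/-- The abscissa of the image of a point under the automorphism of order three of a curve with
`c₄ = 0`. -/
noncomputable def cmX (ω x : F) : F := ω * (x + W.b₂ / 12) - W.b₂ / 12

/-- The ordinate of the image of a point under the automorphism of order three of a curve with
`c₄ = 0`. -/
noncomputable def cmY (ω x y : F) : F := y + W.a₁ * (x - cmX W ω x) / 2

/-- Completing the square and the cube removes the linear term, so multiplying x + b₂/12 by ω
preserves the curve. -/
theorem equation_iff_of_c₄_eq_zero (hc : W.c₄ = 0) (x y : F) :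
    W.Equation x y ↔
      (2 * y + W.a₁ * x + W.a₃) ^ 2 = 4 * (x + W.b₂ / 12) ^ 3 - W.c₆ / 216 := by
  rw [equation_iff]
  simp only [WeierstrassCurve.b₂, WeierstrassCurve.b₄, WeierstrassCurve.b₆,
    WeierstrassCurve.c₄, WeierstrassCurve.c₆] at hc ⊢
  constructor <;> intro h
  · linear_combination 4 * h - (x + (W.a₁ ^ 2 + 4 * W.a₂) / 12) / 12 * hc
  · linear_combination h / 4 + (x + (W.a₁ ^ 2 + 4 * W.a₂) / 12) / 48 * hc

theorem cm_eta (ω x y : F) :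
    2 * cmY W ω x y + W.a₁ * cmX W ω x + W.a₃ = 2 * y + W.a₁ * x + W.a₃ := by
  rw [cmY]
  ring

theorem equation_cm (hω : ω ^ 2 + ω + 1 = 0) (hc : W.c₄ = 0) {x y : F} (h : W.Equation x y) :
    W.Equation (cmX W ω x) (cmY W ω x y) := by
  rw [equation_iff_of_c₄_eq_zero W hc] at h ⊢
  rw [cm_eta, h, cmX]
  linear_combination -4 * (ω - 1) * (x + W.b₂ / 12) ^ 3 * hω

theorem negY_cm (ω x y : F) : W.negY (cmX W ω x) (cmY W ω x y) = cmY W ω x (W.negY x y) := by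
  rw [negY, negY, cmY, cmY]
  ring

theorem cmX_injective (hω : ω ^ 2 + ω + 1 = 0) : Function.Injective (cmX W ω) := by
  intro x x' h
  have h0 : ω ≠ 0 := by rintro rfl; simp at hω
  rw [cmX, cmX, sub_left_inj, mul_right_inj' h0] at h
  exact add_right_cancel h

variable [DecidableEq F]

/-- The map fixes η = 2y + a₁x + a₃ and multiplies x + b₂/12 by ω, so slopes of η are multiplied by
ω⁻¹ = ω². The a₁ term translates this back to slopes of y. -/
theorem slope_cm (hω : ω ^ 2 + ω + 1 = 0) (hc : W.c₄ = 0) {x₁ x₂ y₁ y₂ : F}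
    (h₁ : W.Equation x₁ y₁) (h₂ : W.Equation x₂ y₂) (hxy : ¬(x₁ = x₂ ∧ y₁ = W.negY x₂ y₂)) :
    W.slope (cmX W ω x₁) (cmX W ω x₂) (cmY W ω x₁ y₁) (cmY W ω x₂ y₂) =
      ω ^ 2 * (W.slope x₁ x₂ y₁ y₂ + W.a₁ * (1 - ω) / 2) := by
  have h0 : ω ≠ 0 := by rintro rfl; simp at hω
  by_cases hx : x₁ = x₂
  · have hy : y₁ ≠ W.negY x₂ y₂ := fun h => hxy ⟨hx, h⟩
    obtain rfl := hx
    obtain rfl := Y_eq_of_Y_ne h₁ h₂ rfl hy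
    have hy' : cmY W ω x₁ y₁ ≠ W.negY (cmX W ω x₁) (cmY W ω x₁ y₁) := by
      rw [negY_cm, cmY, cmY]
      exact fun h => hy (add_right_cancel h)
    have hη : 2 * y₁ + W.a₁ * x₁ + W.a₃ ≠ 0 := fun h0 => hy (by
      rw [negY]
      linear_combination h0)
    rw [slope_of_Y_ne rfl hy, slope_of_Y_ne rfl hy', negY, negY,
      show y₁ - (-y₁ - W.a₁ * x₁ - W.a₃) = 2 * y₁ + W.a₁ * x₁ + W.a₃ by ring,
      show cmY W ω x₁ y₁ - (-cmY W ω x₁ y₁ - W.a₁ * cmX W ω x₁ - W.a₃) =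
        2 * cmY W ω x₁ y₁ + W.a₁ * cmX W ω x₁ + W.a₃ by ring, cm_eta]
    field_simp
    rw [cmY, cmX]
    simp only [WeierstrassCurve.b₂, WeierstrassCurve.b₄, WeierstrassCurve.c₄] at hc ⊢
    grind
  · have hx' : cmX W ω x₁ ≠ cmX W ω x₂ := fun h => hx (cmX_injective W hω h)
    have hx₁ : x₁ - x₂ ≠ 0 := sub_ne_zero.2 hx
    have hx₂ : cmX W ω x₁ - cmX W ω x₂ = ω * (x₁ - x₂) := by rw [cmX, cmX]; ring
    rw [slope_of_X_ne hx, slope_of_X_ne hx', hx₂, cmY, cmY]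
    rw [show y₁ + W.a₁ * (x₁ - cmX W ω x₁) / 2 - (y₂ + W.a₁ * (x₂ - cmX W ω x₂) / 2) =
      y₁ - y₂ + W.a₁ * (x₁ - x₂ - (cmX W ω x₁ - cmX W ω x₂)) / 2 by ring, hx₂]
    field_simp
    linear_combination -(2 * (y₁ - y₂) + W.a₁ * (x₁ - x₂) * (1 - ω)) * (ω - 1) * hω

/-- The automorphism of order three of an elliptic curve with `c₄ = 0`. -/
noncomputable def cmFun [W.IsElliptic] (hω : ω ^ 2 + ω + 1 = 0) (hc : W.c₄ = 0) :
    W.Point → W.Point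
  | .zero => 0
  | .some x y h => .some (cmX W ω x) (cmY W ω x y)
      (equation_iff_nonsingular.1 (equation_cm W hω hc h.1))

theorem cmFun_add [W.IsElliptic] (hω : ω ^ 2 + ω + 1 = 0) (hc : W.c₄ = 0) (P Q : W.Point) :
    cmFun W hω hc (P + Q) = cmFun W hω hc P + cmFun W hω hc Q := by
  rcases P with _ | ⟨x₁, y₁, h₁⟩
  · rw [← Point.zero_def, zero_add]
    exact (zero_add _).symm
  rcases Q with _ | ⟨x₂, y₂, h₂⟩
  · rw [← Point.zero_def, add_zero]
    exact (add_zero _).symm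
  by_cases hxy : x₁ = x₂ ∧ y₁ = W.negY x₂ y₂
  · rw [Point.add_of_Y_eq hxy.1 hxy.2]
    refine (Point.add_of_Y_eq (congrArg _ hxy.1) ?_).symm
    rw [negY_cm, hxy.1, hxy.2]
  · have hxy' : ¬(cmX W ω x₁ = cmX W ω x₂ ∧
        cmY W ω x₁ y₁ = W.negY (cmX W ω x₂) (cmY W ω x₂ y₂)) := by
      rintro ⟨hx, hy⟩
      have hx := cmX_injective W hω hx
      refine hxy ⟨hx, ?_⟩
      rw [negY_cm, hx, cmY, cmY] at hy
      exact add_right_cancel hy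
    rw [Point.add_some hxy]
    simp only [cmFun]
    rw [Point.add_some hxy', Point.some.injEq]
    have hX : cmX W ω (W.addX x₁ x₂ (W.slope x₁ x₂ y₁ y₂)) = W.addX (cmX W ω x₁) (cmX W ω x₂)
        (W.slope (cmX W ω x₁) (cmX W ω x₂) (cmY W ω x₁ y₁) (cmY W ω x₂ y₂)) := by
      rw [slope_cm W hω hc h₁.1 h₂.1 hxy]
      set ℓ := W.slope x₁ x₂ y₁ y₂
      simp only [cmX, addX, WeierstrassCurve.b₂]
      grind
    refine ⟨hX, ?_⟩
    rw [addY, addY, ← negY_cm, negAddY, negAddY, ← hX]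
    congr 1
    rw [slope_cm W hω hc h₁.1 h₂.1 hxy]
    set x₃ := W.addX x₁ x₂ (W.slope x₁ x₂ y₁ y₂)
    set ℓ := W.slope x₁ x₂ y₁ y₂
    simp only [cmX, cmY]
    grind

end ComplexMultiplication

/-! ### Complex multiplication for j = 0 -/

section EndomorphismOfOrderThree

open WeierstrassCurve.Affine

open scoped Polynomial in
theorem isRationalEndo_cm {F : Type*} [Field F] [CharZero F] [DecidableEq F]
    (W : WeierstrassCurve.Affine F) [W.IsElliptic] {ω : F} (hω : ω ^ 2 + ω + 1 = 0)
    (hc : W.c₄ = 0) {x y : F} (hxy : W.Nonsingular x y) :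
    IsRationalEndo W (AddMonoidHom.mk' (cmFun W hω hc) (cmFun_add W hω hc)) := by
  set f : F[X] := Polynomial.C ω * (Polynomial.X + Polynomial.C (W.b₂ / 12)) -
    Polynomial.C (W.b₂ / 12) with hf
  set g : F[X] := Polynomial.C (W.a₁ / 2) * (Polynomial.X - f) with hg
  have hfx (x y : F) : (Polynomial.C f).evalEval x y = cmX W ω x := by
    rw [Polynomial.evalEval_C]
    simp [hf, cmX]
  have hgx (x y : F) : (Polynomial.X + Polynomial.C g).evalEval x y = cmY W ω x y := by
    rw [Polynomial.evalEval_add, Polynomial.evalEval_X, Polynomial.evalEval_C]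
    simp only [hg, hf, cmX, cmY, Polynomial.eval_mul, Polynomial.eval_sub, Polynomial.eval_add,
      Polynomial.eval_C, Polynomial.eval_X]
    ring
  refine Or.inr ⟨Polynomial.C f, Polynomial.X + Polynomial.C g, 1,
    ⟨x, y, hxy, by simp⟩, fun x y hxy _ => ?_⟩
  simp only [hfx, hgx, Polynomial.evalEval_one, div_one]
  exact ⟨equation_iff_nonsingular.1 (equation_cm W hω hc hxy.1), rfl⟩

theorem exists_omega {F : Type*} [Field F] [IsAlgClosed F] [CharZero F] :
    ∃ ω : F, ω ^ 2 + ω + 1 = 0 := by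
  obtain ⟨s, hs⟩ := IsAlgClosed.exists_pow_nat_eq (-3 : F) two_pos
  exact ⟨(-1 + s) / 2, by linear_combination hs / 4⟩

theorem zsmul_eq_zero_or_self_of_two_nsmul {A : Type*} [AddCommGroup A] {P : A} (hP : 2 • P = 0)
    (n : ℤ) : n • P = 0 ∨ n • P = P := by
  have h2 : (2 : ℤ) • P = 0 := by exact_mod_cast hP
  rcases Int.even_or_odd' n with ⟨k, rfl | rfl⟩
  · left
    rw [mul_comm, mul_zsmul, h2, zsmul_zero]
  · right
    rw [add_zsmul, mul_comm, mul_zsmul, h2, zsmul_zero, zero_add, one_zsmul]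

/-- An elliptic curve with `j = 0` over a field of characteristic zero has complex
multiplication. -/
theorem hasCM_of_c₄_eq_zero {K : Type*} [Field K] [CharZero K] (E : WeierstrassCurve K)
    [E.IsElliptic] (hc : E.c₄ = 0) : HasCM E := by
  classical
  unfold HasCM
  set W := (E.map (algebraMap K (AlgebraicClosure K))).toAffine with hW
  have : W.IsElliptic := inferInstanceAs
    (E.map (algebraMap K (AlgebraicClosure K))).IsElliptic
  have : CharZero (AlgebraicClosure K) := charZero_of_injective_algebraMap
    (algebraMap K (AlgebraicClosure K)).injective
  have hc' : W.c₄ = 0 := by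
    rw [hW]
    exact (E.map_c₄ _).trans (by rw [hc, map_zero])
  have hc6 : W.c₆ ≠ 0 := fun h6 => by
    have h := W.c_relation
    rw [hc', h6] at h
    have : W.Δ = 0 := by
      have : (1728 : AlgebraicClosure K) * W.Δ = 0 := by rw [h]; ring
      simpa using this
    exact W.isUnit_Δ.ne_zero this
  obtain ⟨ω, hω⟩ := exists_omega (F := AlgebraicClosure K)
  -- The point with x + b₂/12 = u has η = 0, so it is 2-torsion and integers send it to 0 or itself.
  -- As u ≠ 0, multiplication by ω moves it to another affine point.
  obtain ⟨u, hu⟩ := IsAlgClosed.exists_pow_nat_eq (W.c₆ / 864) three_pos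
  have hu0 : u ≠ 0 := by
    rintro rfl
    apply hc6
    linear_combination -864 * hu
  have hω1 : ω ≠ 1 := by
    rintro rfl
    norm_num at hω
  set x := u - W.b₂ / 12 with hx
  set y := -(W.a₁ * x + W.a₃) / 2 with hy
  have hη : 2 * y + W.a₁ * x + W.a₃ = 0 := by rw [hy]; ring
  have hns : W.Nonsingular x y := by
    rw [← equation_iff_nonsingular, equation_iff_of_c₄_eq_zero W hc', hη, hx, sub_add_cancel, hu]
    ring
  refine ⟨_, isRationalEndo_cm W hω hc' hns, fun n hn => ?_⟩
  have hP := (two_nsmul_some_eq_zero_iff W hns).2 hη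
  have hφ := DFunLike.congr_fun hn (Point.some x y hns)
  have hφ' : cmFun W hω hc' (Point.some x y hns) = n • Point.some x y hns := hφ
  rcases zsmul_eq_zero_or_self_of_two_nsmul hP n with h | h
  · rw [h] at hφ'
    exact Point.some_ne_zero _ hφ'
  · rw [h] at hφ'
    have := (Point.some.inj hφ').1
    rw [cmX, hx, sub_add_cancel, sub_left_inj] at this
    exact hω1 (mul_eq_right₀ hu0 |>.1 this)

end EndomorphismOfOrderThree

/-! ### Roots of cubics in towers of square roots -/

section SquareRootTowers

variable {K Ω : Type*} [Field K] [Field Ω] [Algebra K Ω]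

open IntermediateField

/-- The field `M(z)` for an element `z ∉ M` with `z² ∈ M`. -/
def adjoinSqrt (M : IntermediateField K Ω) (z : Ω) (hz : z ^ 2 ∈ M) (hzM : z ∉ M) :
    IntermediateField K Ω where
  carrier := {w | ∃ a ∈ M, ∃ b ∈ M, w = a + b * z}
  mul_mem' := by
    rintro _ _ ⟨a, ha, b, hb, rfl⟩ ⟨c, hc, d, hd, rfl⟩
    exact ⟨a * c + b * d * z ^ 2, add_mem (mul_mem ha hc) (mul_mem (mul_mem hb hd) hz),
      a * d + b * c, add_mem (mul_mem ha hd) (mul_mem hb hc), by ring⟩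
  add_mem' := by
    rintro _ _ ⟨a, ha, b, hb, rfl⟩ ⟨c, hc, d, hd, rfl⟩
    exact ⟨a + c, add_mem ha hc, b + d, add_mem hb hd, by ring⟩
  algebraMap_mem' r := ⟨_, M.algebraMap_mem r, 0, zero_mem _, by ring⟩
  inv_mem' := by
    rintro _ ⟨a, ha, b, hb, rfl⟩
    by_cases hn : a ^ 2 - b ^ 2 * z ^ 2 = 0
    · have hb0 : b = 0 := by
        by_contra hb0
        have : (z - a / b) * (z + a / b) = 0 := by
          field_simp
          linear_combination -hn
        rcases mul_eq_zero.1 this with h | h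
        · exact hzM (by rw [sub_eq_zero.1 h]; exact div_mem ha hb)
        · exact hzM (by rw [eq_neg_of_add_eq_zero_left h]; exact neg_mem (div_mem ha hb))
      have ha0 : a = 0 := by simpa [hb0] using hn
      exact ⟨0, zero_mem _, 0, zero_mem _, by simp [ha0, hb0]⟩
    · have hN : a ^ 2 - b ^ 2 * z ^ 2 ∈ M := sub_mem (pow_mem ha 2) (mul_mem (pow_mem hb 2) hz)
      refine ⟨a / (a ^ 2 - b ^ 2 * z ^ 2), div_mem ha hN, -b / (a ^ 2 - b ^ 2 * z ^ 2),
        div_mem (neg_mem hb) hN, inv_eq_of_mul_eq_one_right ?_⟩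
      field_simp
      ring

theorem exists_eq_add_mul_of_mem_sup {M : IntermediateField K Ω} {z : Ω} (hz : z ^ 2 ∈ M)
    (hzM : z ∉ M) {w : Ω} (hw : w ∈ M ⊔ K⟮z⟯) : ∃ a ∈ M, ∃ b ∈ M, w = a + b * z := by
  have hle : M ⊔ K⟮z⟯ ≤ adjoinSqrt M z hz hzM :=
    sup_le (fun a ha => ⟨a, ha, 0, zero_mem _, by ring⟩)
      (adjoin_simple_le_iff.2 ⟨0, zero_mem _, 1, one_mem _, by ring⟩)
  exact hle hw

/-- If a depressed cubic has a root in a quadratic extension of a field, then it has one in that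
field. -/
theorem exists_root_of_root_mem_sup {M : IntermediateField K Ω} {z : Ω} (hz : z ^ 2 ∈ M)
    {p q θ : Ω} (hp : p ∈ M) (hq : q ∈ M) (hθ : θ ∈ M ⊔ K⟮z⟯) (hf : θ ^ 3 + p * θ + q = 0) :
    ∃ θ' ∈ M, θ' ^ 3 + p * θ' + q = 0 := by
  by_cases hzM : z ∈ M
  · rw [sup_eq_left.2 (adjoin_simple_le_iff.2 hzM)] at hθ
    exact ⟨θ, hθ, hf⟩
  obtain ⟨a, ha, b, hb, rfl⟩ := exists_eq_add_mul_of_mem_sup hz hzM hθ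
  by_cases hb0 : b = 0
  · exact ⟨a, ha, by simpa [hb0] using hf⟩
  have h1 : (3 * a ^ 2 * b + b ^ 3 * z ^ 2 + p * b) * z =
      -(a ^ 3 + 3 * a * b ^ 2 * z ^ 2 + p * a + q) := by linear_combination hf
  have hm3 : (3 : Ω) ∈ M := ofNat_mem M 3
  have h2 : 3 * a ^ 2 * b + b ^ 3 * z ^ 2 + p * b ∈ M :=
    add_mem (add_mem (mul_mem (mul_mem hm3 (pow_mem ha 2)) hb) (mul_mem (pow_mem hb 3) hz))
      (mul_mem hp hb)
  have h3 : -(a ^ 3 + 3 * a * b ^ 2 * z ^ 2 + p * a + q) ∈ M :=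
    neg_mem (add_mem (add_mem (add_mem (pow_mem ha 3)
      (mul_mem (mul_mem (mul_mem hm3 ha) (pow_mem hb 2)) hz)) (mul_mem hp ha)) hq)
  have h4 : 3 * a ^ 2 * b + b ^ 3 * z ^ 2 + p * b = 0 := by
    by_contra h4
    exact hzM (by rw [eq_div_of_mul_eq h4 ((mul_comm _ _).trans h1)]; exact div_mem h3 h2)
  have h5 : b ^ 2 * z ^ 2 = -3 * a ^ 2 - p := by
    apply mul_left_cancel₀ hb0
    linear_combination h4
  rw [h4] at h1
  -- The coefficient of z vanishes, so a - bz is a root too. The roots sum to zero, which makes -2a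
  -- the third one.
  refine ⟨-2 * a, mul_mem (neg_mem (ofNat_mem M 2)) ha, ?_⟩
  linear_combination h1 - 3 * a * h5

/-- `SqrtTower M N` says that `N` arises from `M` by adjoining finitely many square roots. -/
inductive SqrtTower (M : IntermediateField K Ω) : IntermediateField K Ω → Prop
  | base : SqrtTower M M
  | step {N : IntermediateField K Ω} {z : Ω} (hN : SqrtTower M N) (hz : z ^ 2 ∈ N) :
      SqrtTower M (N ⊔ K⟮z⟯)

theorem SqrtTower.le {M N : IntermediateField K Ω} (h : SqrtTower M N) : M ≤ N := by
  induction h with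
  | base => exact le_rfl
  | step _ _ ih => exact ih.trans le_sup_left

theorem SqrtTower.exists_root {M N : IntermediateField K Ω} (h : SqrtTower M N) {p q θ : Ω}
    (hp : p ∈ M) (hq : q ∈ M) (hθ : θ ∈ N) (hf : θ ^ 3 + p * θ + q = 0) :
    ∃ θ' ∈ M, θ' ^ 3 + p * θ' + q = 0 := by
  induction h generalizing θ with
  | base => exact ⟨θ, hθ, hf⟩
  | step hN hz ih =>
    obtain ⟨θ', hθ', hf'⟩ := exists_root_of_root_mem_sup hz (hN.le hp) (hN.le hq) hθ hf
    exact ih hθ' hf'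

theorem SqrtTower.exists_mem {M N : IntermediateField K Ω} (h : SqrtTower M N) {z : Ω}
    (hz : z ^ 2 ∈ N) : ∃ N', SqrtTower M N' ∧ N ≤ N' ∧ z ∈ N' :=
  ⟨_, h.step hz, le_sup_left, le_sup_right (a := N) (mem_adjoin_simple_self K z)⟩

end SquareRootTowers

/-! ### The quartic of the 3-torsion and its resolvent cubic -/

section ThreeTorsion

variable {Ω : Type*} [Field Ω]

/-- A multiple of the third division polynomial, in the variable `X = 12 x + b₂`. -/
def threeDiv (c₄ c₆ X : Ω) : Ω := X ^ 4 - 6 * c₄ * X ^ 2 - 8 * c₆ * X - 3 * c₄ ^ 2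

/-- A multiple of the two-division polynomial, in the variable `X = 12 x + b₂`. -/
def twoDiv (c₄ c₆ X : Ω) : Ω := X ^ 3 - 3 * c₄ * X - 2 * c₆

/-- Euler's solution of the quartic: the σᵢ² are the roots of the resolvent cubic (Y - c₄)³ =
-1728δ³. -/
theorem threeDiv_eq_prod {c₄ c₆ δ ω σ₁ σ₂ σ₃ : Ω} (hω : ω ^ 2 + ω + 1 = 0)
    (h₁ : σ₁ ^ 2 = c₄ - 12 * δ) (h₂ : σ₂ ^ 2 = c₄ - 12 * (ω * δ))
    (h₃ : σ₃ ^ 2 = c₄ - 12 * (ω ^ 2 * δ)) (h : σ₁ * σ₂ * σ₃ = c₆) (X : Ω) :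
    threeDiv c₄ c₆ X = (X - (σ₁ + σ₂ + σ₃)) * (X - (σ₁ - σ₂ - σ₃)) * (X - (-σ₁ + σ₂ - σ₃)) *
      (X - (-σ₁ - σ₂ + σ₃)) := by
  have hs : σ₁ ^ 2 + σ₂ ^ 2 + σ₃ ^ 2 = 3 * c₄ := by
    linear_combination h₁ + h₂ + h₃ - 12 * δ * hω
  have hp : σ₁ ^ 2 * σ₂ ^ 2 + σ₁ ^ 2 * σ₃ ^ 2 + σ₂ ^ 2 * σ₃ ^ 2 = 3 * c₄ ^ 2 := by
    rw [h₁, h₂, h₃]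
    linear_combination (-24 * c₄ * δ + 144 * ω * δ ^ 2) * hω
  rw [threeDiv]
  linear_combination 2 * X ^ 2 * hs + 8 * X * h - (σ₁ ^ 2 + σ₂ ^ 2 + σ₃ ^ 2 + 3 * c₄) * hs + 4 * hp

theorem exists_sqrts [IsAlgClosed Ω] {c₄ c₆ δ ω : Ω} (hω : ω ^ 2 + ω + 1 = 0)
    (hδ : 1728 * δ ^ 3 = c₄ ^ 3 - c₆ ^ 2) :
    ∃ σ₁ σ₂ σ₃ : Ω, σ₁ ^ 2 = c₄ - 12 * δ ∧ σ₂ ^ 2 = c₄ - 12 * (ω * δ) ∧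
      σ₃ ^ 2 = c₄ - 12 * (ω ^ 2 * δ) ∧ σ₁ * σ₂ * σ₃ = c₆ := by
  obtain ⟨σ₁, h₁⟩ := IsAlgClosed.exists_pow_nat_eq (c₄ - 12 * δ) two_pos
  obtain ⟨σ₂, h₂⟩ := IsAlgClosed.exists_pow_nat_eq (c₄ - 12 * (ω * δ)) two_pos
  obtain ⟨σ₃, h₃⟩ := IsAlgClosed.exists_pow_nat_eq (c₄ - 12 * (ω ^ 2 * δ)) two_pos
  have h : (σ₁ * σ₂ * σ₃ - c₆) * (σ₁ * σ₂ * σ₃ + c₆) = 0 := by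
    have : (σ₁ * σ₂ * σ₃) ^ 2 = c₆ ^ 2 := by
      rw [mul_pow, mul_pow, h₁, h₂, h₃]
      grind
    linear_combination this
  rcases mul_eq_zero.1 h with h | h
  · exact ⟨σ₁, σ₂, σ₃, h₁, h₂, h₃, sub_eq_zero.1 h⟩
  · exact ⟨-σ₁, σ₂, σ₃, by rw [neg_sq, h₁], h₂, h₃, by linear_combination -h⟩

open IntermediateField

variable {K : Type*} [Field K] [Algebra K Ω] [CharZero Ω] [IsAlgClosed Ω]

/-- Two suitable roots of the quartic add up to 2σ₁, and σ₁² = c₄ - 12δ recovers δ. -/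
theorem cubeRoot_mem {L : IntermediateField K Ω} {c₄ c₆ : Ω} (hc₄ : c₄ ∈ L)
    (hL : ∀ X : Ω, threeDiv c₄ c₆ X = 0 → X ∈ L) {δ : Ω} (hδ : 1728 * δ ^ 3 = c₄ ^ 3 - c₆ ^ 2) :
    δ ∈ L := by
  obtain ⟨ω, hω⟩ := exists_omega (F := Ω)
  obtain ⟨σ₁, σ₂, σ₃, h₁, h₂, h₃, h⟩ := exists_sqrts hω hδ
  have hprod := threeDiv_eq_prod hω h₁ h₂ h₃ h
  have hX₁ : σ₁ + σ₂ + σ₃ ∈ L := hL _ (by rw [hprod]; ring)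
  have hX₂ : σ₁ - σ₂ - σ₃ ∈ L := hL _ (by rw [hprod]; ring)
  have hσ : δ = (c₄ - ((σ₁ + σ₂ + σ₃ + (σ₁ - σ₂ - σ₃)) / 2) ^ 2) / 12 := by
    linear_combination (1 / 12) * h₁
  rw [hσ]
  exact div_mem (sub_mem hc₄ (pow_mem (div_mem (add_mem hX₁ hX₂) (ofNat_mem L 2)) 2))
    (ofNat_mem L 12)

/-- The field generated by the points of order three arises from `K(∛Δ)` by adjoining square
roots. -/
theorem exists_sqrtTower (c₄ c₆ : K) {δ : Ω}
    (hδ : 1728 * δ ^ 3 = algebraMap K Ω c₄ ^ 3 - algebraMap K Ω c₆ ^ 2) :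
    ∃ N : IntermediateField K Ω, SqrtTower K⟮δ⟯ N ∧
      ∀ X : Ω, threeDiv (algebraMap K Ω c₄) (algebraMap K Ω c₆) X = 0 →
        X ∈ N ∧ ∀ Y : Ω, 3 * Y ^ 2 = twoDiv (algebraMap K Ω c₄) (algebraMap K Ω c₆) X → Y ∈ N := by
  set C₄ := algebraMap K Ω c₄
  set C₆ := algebraMap K Ω c₆
  have hC₄ (N : IntermediateField K Ω) : C₄ ∈ N := N.algebraMap_mem c₄
  have hC₆ (N : IntermediateField K Ω) : C₆ ∈ N := N.algebraMap_mem c₆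
  obtain ⟨s, hs⟩ := IsAlgClosed.exists_pow_nat_eq (-3 : Ω) two_pos
  set ω := (-1 + s) / 2 with hω'
  have hω : ω ^ 2 + ω + 1 = 0 := by linear_combination hs / 4
  obtain ⟨σ₁, σ₂, σ₃, h₁, h₂, h₃, h⟩ := exists_sqrts hω hδ
  have hprod := threeDiv_eq_prod hω h₁ h₂ h₃ h
  obtain ⟨N₀, t₀, -, hsN⟩ := (SqrtTower.base (M := K⟮δ⟯)).exists_mem (z := s)
    (by rw [hs]; exact neg_mem (ofNat_mem _ 3))
  have hδN : δ ∈ N₀ := t₀.le (mem_adjoin_simple_self K δ)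
  have hωN : ω ∈ N₀ := div_mem (add_mem (neg_mem (one_mem _)) hsN) (ofNat_mem _ 2)
  obtain ⟨N₁, t₁, l₁, m₁⟩ := t₀.exists_mem (z := σ₁)
    (by rw [h₁]; exact sub_mem (hC₄ _) (mul_mem (ofNat_mem _ 12) hδN))
  obtain ⟨N₂, t₂, l₂, m₂⟩ := t₁.exists_mem (z := σ₂)
    (by rw [h₂]; exact sub_mem (hC₄ _) (mul_mem (ofNat_mem _ 12) (l₁ (mul_mem hωN hδN))))
  obtain ⟨N₃, t₃, l₃, m₃⟩ := t₂.exists_mem (z := σ₃)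
    (by
      rw [h₃]
      exact sub_mem (hC₄ _) (mul_mem (ofNat_mem _ 12)
        (l₂ (l₁ (mul_mem (pow_mem hωN 2) hδN)))))
  have hσ₁ : σ₁ ∈ N₃ := l₃ (l₂ m₁)
  have hσ₂ : σ₂ ∈ N₃ := l₃ m₂
  have hX : ∀ X : Ω, threeDiv C₄ C₆ X = 0 → X ∈ N₃ ∧ (X = σ₁ + σ₂ + σ₃ ∨ X = σ₁ - σ₂ - σ₃ ∨
      X = -σ₁ + σ₂ - σ₃ ∨ X = -σ₁ - σ₂ + σ₃) := by
    intro X hX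
    rw [hprod, mul_eq_zero, mul_eq_zero, mul_eq_zero] at hX
    simp only [sub_eq_zero (a := X), or_assoc] at hX
    refine ⟨?_, hX⟩
    rcases hX with rfl | rfl | rfl | rfl
    · exact add_mem (add_mem hσ₁ hσ₂) m₃
    · exact sub_mem (sub_mem hσ₁ hσ₂) m₃
    · exact sub_mem (add_mem (neg_mem hσ₁) hσ₂) m₃
    · exact add_mem (sub_mem (neg_mem hσ₁) hσ₂) m₃
  -- Each of the four abscissae needs one more square root; the ordinates above it are Y₀ and -Y₀.
  have hstep (X : Ω) (hXN : X ∈ N₃) (N : IntermediateField K Ω) (hN : N₃ ≤ N)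
      (t : SqrtTower K⟮δ⟯ N) : ∃ N', SqrtTower K⟮δ⟯ N' ∧ N ≤ N' ∧
        ∀ Y : Ω, 3 * Y ^ 2 = twoDiv C₄ C₆ X → Y ∈ N' := by
    obtain ⟨Y₀, hY₀⟩ := IsAlgClosed.exists_pow_nat_eq (twoDiv C₄ C₆ X / 3) two_pos
    obtain ⟨N', t', l', m'⟩ := t.exists_mem (z := Y₀) (by
      rw [hY₀, twoDiv]
      have := hN hXN
      exact div_mem (sub_mem (sub_mem (pow_mem this 3) (mul_mem (mul_mem (ofNat_mem _ 3) (hC₄ _))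
        this)) (mul_mem (ofNat_mem _ 2) (hC₆ _))) (ofNat_mem _ 3))
    refine ⟨N', t', l', fun Y hY => ?_⟩
    have : (Y - Y₀) * (Y + Y₀) = 0 := by linear_combination (1 / 3) * hY - hY₀
    rcases mul_eq_zero.1 this with h | h
    · rwa [sub_eq_zero.1 h]
    · rw [eq_neg_of_add_eq_zero_left h]
      exact neg_mem m'
  have root (X : Ω) (h : X = σ₁ + σ₂ + σ₃ ∨ X = σ₁ - σ₂ - σ₃ ∨ X = -σ₁ + σ₂ - σ₃ ∨
      X = -σ₁ - σ₂ + σ₃) : X ∈ N₃ := (hX X (by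
    rw [hprod]
    rcases h with rfl | rfl | rfl | rfl <;> ring)).1
  obtain ⟨N₄, t₄, l₄, m₄⟩ := hstep _ (root (σ₁ + σ₂ + σ₃) (by simp)) _ le_rfl t₃
  obtain ⟨N₅, t₅, l₅, m₅⟩ := hstep _ (root (σ₁ - σ₂ - σ₃) (by simp)) _ l₄ t₄
  obtain ⟨N₆, t₆, l₆, m₆⟩ := hstep _ (root (-σ₁ + σ₂ - σ₃) (by simp)) _ (l₄.trans l₅) t₅
  obtain ⟨N₇, t₇, l₇, m₇⟩ := hstep _ (root (-σ₁ - σ₂ + σ₃) (by simp)) _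
    (l₄.trans (l₅.trans l₆)) t₆
  refine ⟨N₇, t₇, fun X h => ?_⟩
  obtain ⟨hXN, hX⟩ := hX X h
  refine ⟨l₇ (l₆ (l₅ (l₄ hXN))), fun Y hY => ?_⟩
  rcases hX with rfl | rfl | rfl | rfl
  · exact l₇ (l₆ (l₅ (m₄ Y hY)))
  · exact l₇ (l₆ (m₅ Y hY))
  · exact l₇ (m₆ Y hY)
  · exact m₇ Y hY

end ThreeTorsion

/-! ### Cubics with a root in a pure cubic field -/

section CubeRoots

variable {K Ω : Type*} [Field K] [Field Ω] [Algebra K Ω]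

/-- The elements `1, δ, δ²` are linearly independent if `δ³` is an element of `K` that is not a
cube. -/
theorem eq_zero_of_add_mul_add_mul_sq_eq_zero {Δ : K} (hΔ : ∀ d : K, d ^ 3 ≠ Δ) {δ : Ω}
    (hδ : δ ^ 3 = algebraMap K Ω Δ) {e a b : K}
    (h : algebraMap K Ω e + algebraMap K Ω a * δ + algebraMap K Ω b * δ ^ 2 = 0) :
    e = 0 ∧ a = 0 ∧ b = 0 := by
  have hinj := (algebraMap K Ω).injective
  have hδK (d : K) : δ ≠ algebraMap K Ω d := by
    rintro rfl
    exact hΔ d (hinj (by rw [map_pow, hδ]))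
  have hlin {u v : K} (h : algebraMap K Ω u + algebraMap K Ω v * δ = 0) : u = 0 ∧ v = 0 := by
    have hv : v = 0 := by
      by_contra hv
      have hv' : algebraMap K Ω v ≠ 0 := by simpa using hv
      refine hδK (-u / v) ?_
      rw [map_div₀, map_neg, eq_div_iff hv']
      linear_combination h
    refine ⟨?_, hv⟩
    rw [hv] at h
    simpa using h
  by_cases hb : b = 0
  · rw [hb] at h
    obtain ⟨h1, h2⟩ := hlin (u := e) (v := a) (by simpa using h)
    exact ⟨h1, h2, hb⟩
  · exfalso
    -- Multiplying the relation by bδ - a cancels the δ² terms.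
    obtain ⟨h1, h2⟩ := hlin (u := b ^ 2 * Δ - a * e) (v := b * e - a ^ 2) (by
      simp only [map_sub, map_mul, map_pow]
      rw [← hδ]
      linear_combination (algebraMap K Ω b * δ - algebraMap K Ω a) * h)
    refine hΔ (a / b) ?_
    rw [div_pow, div_eq_iff (pow_ne_zero 3 hb)]
    linear_combination -b * h1 - a * h2

open IntermediateField

theorem exists_eq_of_mem_adjoin_cubeRoot {Δ : K} {δ : Ω} (hδ : δ ^ 3 = algebraMap K Ω Δ) {θ : Ω}
    (hθ : θ ∈ K⟮δ⟯) : ∃ e a b : K,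
      θ = algebraMap K Ω e + algebraMap K Ω a * δ + algebraMap K Ω b * δ ^ 2 := by
  have hm : (Polynomial.X ^ 3 - Polynomial.C Δ).Monic := Polynomial.monic_X_pow_sub_C Δ three_ne_zero
  have haeval : Polynomial.aeval δ (Polynomial.X ^ 3 - Polynomial.C Δ) = 0 := by
    simp [hδ]
  have hint : IsIntegral K δ := ⟨_, hm, by simpa [Polynomial.aeval_def] using haeval⟩
  rw [← IntermediateField.mem_toSubalgebra, adjoin_simple_toSubalgebra_of_isAlgebraic hint.isAlgebraic,
    Algebra.adjoin_singleton_eq_range_aeval] at hθ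
  obtain ⟨p, rfl⟩ := hθ
  set r := p %ₘ (Polynomial.X ^ 3 - Polynomial.C Δ) with hr
  have hpr : Polynomial.aeval δ p = Polynomial.aeval δ r :=
    (Polynomial.aeval_modByMonic_eq_self_of_root haeval).symm
  have hdeg : r.natDegree < 3 := by
    have := Polynomial.natDegree_modByMonic_lt p hm (fun h => by
      have := congrArg Polynomial.natDegree h
      simp at this)
    simpa using this
  refine ⟨r.coeff 0, r.coeff 1, r.coeff 2, ?_⟩
  change Polynomial.aeval δ p = _
  rw [hpr, Polynomial.aeval_eq_sum_range' hdeg]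
  simp [Finset.sum_range_succ, Algebra.smul_def]

theorem twoDiv_algebraMap (c₄ c₆ x : K) :
    twoDiv (algebraMap K Ω c₄) (algebraMap K Ω c₆) (algebraMap K Ω x) =
      algebraMap K Ω (twoDiv c₄ c₆ x) := by
  simp only [twoDiv, map_sub, map_mul, map_pow, map_ofNat]

variable [CharZero K]

theorem exists_param_of_root_mem_adjoin_cubeRoot {c₄ c₆ Δ : K} (hΔ0 : Δ ≠ 0)
    (hrel : 1728 * Δ = c₄ ^ 3 - c₆ ^ 2)
    (hirr : ∀ x : K, twoDiv c₄ c₆ x ≠ 0) {δ θ : Ω} (hδ : δ ^ 3 = algebraMap K Ω Δ)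
    (hθ : θ ∈ K⟮δ⟯) (hf : twoDiv (algebraMap K Ω c₄) (algebraMap K Ω c₆) θ = 0) :
    ∃ t : K, c₄ ^ 3 = Δ * (2 ^ 10 * 3 ^ 3 * t ^ 3 * (1 - 4 * t ^ 3)) := by
  have hinj := (algebraMap K Ω).injective
  have hroot {M : IntermediateField K Ω} (ht : SqrtTower ⊥ M) (hM : θ ∈ M) : False := by
    obtain ⟨θ', hθ', hf'⟩ := ht.exists_root (p := -3 * algebraMap K Ω c₄)
      (q := -2 * algebraMap K Ω c₆) (mul_mem (neg_mem (ofNat_mem _ 3)) (_root_.algebraMap_mem _ _))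
      (mul_mem (neg_mem (ofNat_mem _ 2)) (_root_.algebraMap_mem _ _)) hM (by
        rw [twoDiv] at hf
        linear_combination hf)
    obtain ⟨x, rfl⟩ := IntermediateField.mem_bot.1 hθ'
    refine hirr x (hinj ?_)
    rw [← twoDiv_algebraMap, twoDiv, map_zero]
    linear_combination hf'
  -- If Δ were a cube, K(δ) would lie in a tower of square roots over K, and the cubic would have a
  -- root in K.
  have hcube (d : K) : d ^ 3 ≠ Δ := by
    intro hd
    rw [← hd, map_pow] at hδ
    set D := algebraMap K Ω d with hD
    have h : (δ - D) * (δ ^ 2 + D * δ + D ^ 2) = 0 := by linear_combination hδ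
    rcases mul_eq_zero.1 h with h | h
    · rw [sub_eq_zero.1 h] at hθ
      exact hroot SqrtTower.base ((adjoin_simple_le_iff.2 (_root_.algebraMap_mem _ d)) hθ)
    · obtain ⟨N, hN, -, hmem⟩ := (SqrtTower.base (M := (⊥ : IntermediateField K Ω))).exists_mem
        (z := 2 * δ + D) (by
          rw [show (2 * δ + D) ^ 2 = -3 * D ^ 2 by linear_combination 4 * h]
          exact mul_mem (neg_mem (ofNat_mem _ 3)) (pow_mem (_root_.algebraMap_mem _ d) 2))
      have : CharZero Ω := charZero_of_injective_algebraMap hinj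
      have hδN : δ ∈ N := by
        rw [show δ = (2 * δ + D - D) / 2 by ring]
        exact div_mem (sub_mem hmem (_root_.algebraMap_mem _ d)) (ofNat_mem _ 2)
      exact hroot hN ((adjoin_simple_le_iff.2 hδN) hθ)
  obtain ⟨e, a, b, rfl⟩ := exists_eq_of_mem_adjoin_cubeRoot hδ hθ
  obtain ⟨h0, h1, h2⟩ := eq_zero_of_add_mul_add_mul_sq_eq_zero (K := K) hcube hδ
    (e := e ^ 3 + a ^ 3 * Δ + b ^ 3 * Δ ^ 2 + 6 * e * a * b * Δ - 3 * c₄ * e - 2 * c₆)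
    (a := 3 * e ^ 2 * a + 3 * e * b ^ 2 * Δ + 3 * a ^ 2 * b * Δ - 3 * c₄ * a)
    (b := 3 * e ^ 2 * b + 3 * e * a ^ 2 + 3 * a * b ^ 2 * Δ - 3 * c₄ * b) (by
      rw [twoDiv] at hf
      simp only [map_sub, map_add, map_mul, map_pow, map_ofNat]
      rw [← hδ]
      linear_combination hf)
  have hw : a ^ 3 = b ^ 3 * Δ → a = 0 ∧ b = 0 := by
    intro h
    have hb : b = 0 := by
      by_contra hb
      refine hcube (a / b) ?_
      rw [div_pow, h]
      field_simp
    exact ⟨by simpa [hb] using h, hb⟩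
  have hab : ¬(a = 0 ∧ b = 0) := by
    rintro ⟨rfl, rfl⟩
    refine hirr e ?_
    rw [twoDiv]
    linear_combination h0
  -- The cubic has no X² term, so the trace 3e of the root vanishes.
  have he : e = 0 := by
    have : e * (b ^ 3 * Δ - a ^ 3) = 0 := by linear_combination (b * h1 - a * h2) / 3
    refine (mul_eq_zero.1 this).resolve_right fun h => hab (hw ?_)
    linear_combination -h
  subst he
  have hc₄ : c₄ = a * b * Δ := by
    by_cases ha : a = 0
    · have hb : b ≠ 0 := fun hb => hab ⟨ha, hb⟩
      apply mul_left_cancel₀ hb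
      linear_combination -h2 / 3
    · apply mul_left_cancel₀ ha
      linear_combination -h1 / 3
  set w := a ^ 3 - b ^ 3 * Δ with hw'
  have hw0 : w ≠ 0 := fun h => hab (hw (sub_eq_zero.1 h))
  -- With u = a³Δ and v = b³Δ², this is 4uv - (u + v)² = -(u - v)² applied to 4(c₄³ - c₆²) = 6912Δ.
  have hΔw : Δ * w ^ 2 = -6912 := by
    apply mul_left_cancel₀ hΔ0
    have hc₆ : 2 * c₆ = a ^ 3 * Δ + b ^ 3 * Δ ^ 2 := by linear_combination -h0
    rw [hw']
    rw [hc₄] at hrel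
    linear_combination 4 * hrel - (2 * c₆ + a ^ 3 * Δ + b ^ 3 * Δ ^ 2) * hc₆
  have ha3 : a ^ 3 = w + b ^ 3 * Δ := by rw [hw']; ring
  -- For b = tw/12, the relation Δw² = -6912 gives b³Δ = -4t³w and a³ = w(1 - 4t³).
  refine ⟨12 * b / w, ?_⟩
  have hΔ' : Δ = -6912 / w ^ 2 := by
    rw [eq_div_iff (pow_ne_zero 2 hw0), hΔw]
  rw [hc₄, mul_pow, mul_pow, ha3, hΔ']
  field_simp
  ring

/-- On the family, the roots of the two-division polynomial lie in the field generated by a cube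
root of `Δ` and a third root of unity. -/
theorem exists_coeffs_of_param {c₄ c₆ Δ t : K} (hΔ0 : Δ ≠ 0) (hrel : 1728 * Δ = c₄ ^ 3 - c₆ ^ 2)
    (ht0 : t ≠ 0) (ht1 : 8 * t ^ 3 ≠ 1)
    (hj : c₄ ^ 3 = Δ * (2 ^ 10 * 3 ^ 3 * t ^ 3 * (1 - 4 * t ^ 3))) :
    ∃ a b w : K, b ≠ 0 ∧ w ≠ 0 ∧ Δ * w ^ 2 = -6912 ∧ a * b * Δ = c₄ ∧
      a ^ 3 * Δ + b ^ 3 * Δ ^ 2 = 2 * c₆ ∧ a ^ 3 = w * (1 - 4 * t ^ 3) := by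
  have ht1' : 1 - 8 * t ^ 3 ≠ 0 := fun h => ht1 (by linear_combination -h)
  have hc₆ : c₆ ^ 2 = -1728 * Δ * (1 - 8 * t ^ 3) ^ 2 := by linear_combination hj + hrel
  have hc₆0 : c₆ ≠ 0 := by
    rintro rfl
    have : -1728 * Δ * (1 - 8 * t ^ 3) ^ 2 ≠ 0 := by
      refine mul_ne_zero (mul_ne_zero ?_ hΔ0) (pow_ne_zero 2 ht1')
      norm_num
    exact this (by rw [← hc₆]; ring)
  -- Found by solving 2c₆ = Δ(a³ + b³Δ) = Δw(1 - 8t³) for w.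
  set w := 2 * c₆ / (Δ * (1 - 8 * t ^ 3)) with hw
  have hw0 : w ≠ 0 := div_ne_zero (mul_ne_zero two_ne_zero hc₆0) (mul_ne_zero hΔ0 ht1')
  have hwc : Δ * w * (1 - 8 * t ^ 3) = 2 * c₆ := by
    rw [hw]
    field_simp
  have hΔw : Δ * w ^ 2 = -6912 := by
    apply mul_left_cancel₀ (mul_ne_zero hΔ0 (pow_ne_zero 2 ht1'))
    linear_combination (Δ * w * (1 - 8 * t ^ 3) + 2 * c₆) * hwc + 4 * hc₆
  have hΔ' : Δ = -6912 / w ^ 2 := by rw [eq_div_iff (pow_ne_zero 2 hw0), hΔw]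
  set b := t * w / 12 with hb
  have hb0 : b ≠ 0 := div_ne_zero (mul_ne_zero ht0 hw0) (by norm_num)
  have hb3 : b ^ 3 * Δ = -4 * t ^ 3 * w := by
    rw [hb]
    linear_combination t ^ 3 * w / 1728 * hΔw
  set a := c₄ / (b * Δ) with ha
  have hac : a * b * Δ = c₄ := by
    rw [ha]
    field_simp
  have ha3 : a ^ 3 = w * (1 - 4 * t ^ 3) := by
    have h1 : a ^ 3 * (b ^ 3 * Δ) * Δ ^ 2 = c₄ ^ 3 := by rw [← hac]; ring
    rw [hb3, hj] at h1
    have h2 : -4 * t ^ 3 * w * Δ ^ 2 ≠ 0 := by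
      refine mul_ne_zero (mul_ne_zero (mul_ne_zero ?_ (pow_ne_zero 3 ht0)) hw0) (pow_ne_zero 2 hΔ0)
      norm_num
    apply mul_left_cancel₀ h2
    linear_combination h1 + 4 * t ^ 3 * Δ * (1 - 4 * t ^ 3) * hΔw
  refine ⟨a, b, w, hb0, hw0, hΔw, hac, ?_, ha3⟩
  linear_combination Δ * ha3 + Δ * hb3 + hwc

/-- Cardano's formula: u = aδ and v = bδ² satisfy uv = c₄ and u³ + v³ = 2c₆. -/
theorem twoDiv_eq_prod {c₄ c₆ a b δ ω : Ω} (hω : ω ^ 2 + ω + 1 = 0) (h₄ : a * b * δ ^ 3 = c₄)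
    (h₆ : a ^ 3 * δ ^ 3 + b ^ 3 * (δ ^ 3) ^ 2 = 2 * c₆) (X : Ω) :
    twoDiv c₄ c₆ X = (X - (a * δ + b * δ ^ 2)) * (X - (a * (ω * δ) + b * (ω * δ) ^ 2)) *
      (X - (a * (ω ^ 2 * δ) + b * (ω ^ 2 * δ) ^ 2)) := by
  rw [twoDiv, ← h₄, ← h₆]
  grind

theorem exists_cubeRoot_of_twoDiv_eq_zero [IsAlgClosed Ω] {c₄ c₆ Δ a b : K}
    (h₄ : a * b * Δ = c₄) (h₆ : a ^ 3 * Δ + b ^ 3 * Δ ^ 2 = 2 * c₆) {θ : Ω}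
    (hθ : twoDiv (algebraMap K Ω c₄) (algebraMap K Ω c₆) θ = 0) :
    ∃ δ : Ω, δ ^ 3 = algebraMap K Ω Δ ∧ θ = algebraMap K Ω a * δ + algebraMap K Ω b * δ ^ 2 := by
  have : CharZero Ω := charZero_of_injective_algebraMap (algebraMap K Ω).injective
  obtain ⟨δ, hδ⟩ := IsAlgClosed.exists_pow_nat_eq (algebraMap K Ω Δ) three_pos
  obtain ⟨ω, hω⟩ := exists_omega (F := Ω)
  have hω3 : ω ^ 3 = 1 := by linear_combination (ω - 1) * hω
  rw [twoDiv_eq_prod (a := algebraMap K Ω a) (b := algebraMap K Ω b) (δ := δ) hω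
    (by rw [hδ, ← h₄, map_mul, map_mul])
    (by rw [hδ]; simpa only [map_add, map_mul, map_pow, map_ofNat] using congrArg (algebraMap K Ω) h₆),
    mul_eq_zero, mul_eq_zero, sub_eq_zero, sub_eq_zero, sub_eq_zero] at hθ
  rcases hθ with (h | h) | h
  · exact ⟨δ, hδ, h⟩
  · exact ⟨ω * δ, by rw [mul_pow, hω3, hδ, one_mul], h⟩
  · exact ⟨ω ^ 2 * δ, by rw [mul_pow, ← pow_mul, mul_comm 2, pow_mul, hω3, hδ, one_pow, one_mul], h⟩

theorem eight_mul_cube_ne_one {t : ℚ} (ht1 : t ≠ 1 / 2) : 8 * t ^ 3 ≠ 1 := by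
  intro h
  have h1 : (2 * t - 1) * (4 * t ^ 2 + 2 * t + 1) = 0 := by linear_combination h
  rcases mul_eq_zero.1 h1 with h2 | h2
  · exact ht1 (by linarith)
  · nlinarith [sq_nonneg (4 * t + 1)]

/-- On the Brau–Jones family, away from `j = 0` and `j = 1728`, the two-division polynomial has no
rational root. -/
theorem twoDiv_ne_zero_of_param {c₄ c₆ Δ t : ℚ} (hΔ0 : Δ ≠ 0)
    (hrel : 1728 * Δ = c₄ ^ 3 - c₆ ^ 2) (ht0 : t ≠ 0) (ht1 : t ≠ 1 / 2)
    (hj : c₄ ^ 3 = Δ * (2 ^ 10 * 3 ^ 3 * t ^ 3 * (1 - 4 * t ^ 3))) (x : ℚ) :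
    twoDiv c₄ c₆ x ≠ 0 := by
  intro hx
  have ht2 := eight_mul_cube_ne_one ht1
  obtain ⟨a, b, w, hb0, hw0, hΔw, h₄, h₆, ha3⟩ := exists_coeffs_of_param hΔ0 hrel ht0 ht2 hj
  obtain ⟨δ, hδ, hxδ⟩ := exists_cubeRoot_of_twoDiv_eq_zero (Ω := AlgebraicClosure ℚ) h₄ h₆
    (θ := algebraMap ℚ _ x) (by rw [twoDiv_algebraMap, hx, map_zero])
  by_cases hcube : ∃ d : ℚ, d ^ 3 = Δ
  · obtain ⟨d, rfl⟩ := hcube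
    have hd0 : d ≠ 0 := by rintro rfl; simp at hΔ0
    -- Since d³w² = -6912 and a³ = w(1 - 4t³), the second cube equals 2 - 8t³.
    have h2 : (2 * t) ^ 3 + (-24 * a / (d * w)) ^ 3 = 2 := by
      rw [div_pow, mul_pow _ a, ha3]
      field_simp
      linear_combination (8 * t ^ 3 - 2) * hΔw
    have := eq_one_of_add_cube_eq_two h2
    exact ht1 (by linarith)
  · refine hb0 (eq_zero_of_add_mul_add_mul_sq_eq_zero (fun d hd => hcube ⟨d, hd⟩) hδ
      (e := -x) (a := a) (b := b) ?_).2.2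
    rw [map_neg, hxδ]
    ring

end CubeRoots

/-! ### Galois theory of the 2-division cubic -/

section CubicFields

open IntermediateField

theorem finrank_adjoin_simple_le_two {K Ω : Type*} [Field K] [Field Ω] [Algebra K Ω] {θ : Ω}
    (u v : K) (h : θ ^ 2 + algebraMap K Ω u * θ + algebraMap K Ω v = 0) :
    Module.finrank K K⟮θ⟯ ≤ 2 := by
  set p : Polynomial K := Polynomial.X ^ 2 + Polynomial.C u * Polynomial.X + Polynomial.C v
  have hp : p.Monic := by simp only [p]; monicity!
  have hdeg : p.natDegree = 2 := by simp only [p]; compute_degree!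
  have haeval : Polynomial.aeval θ p = 0 := by simpa [p] using h
  have hint : IsIntegral K θ := ⟨p, hp, by rwa [← Polynomial.aeval_def]⟩
  rw [adjoin.finrank hint, ← hdeg]
  exact Polynomial.natDegree_le_natDegree (minpoly.min K θ hp haeval)

variable {K : Type*} [Field K]

theorem isAbelianGalois_of_finrank_prime_or_one {L : Type*} [Field L] [Algebra K L]
    [FiniteDimensional K L] [IsGalois K L]
    (h : Module.finrank K L = 1 ∨ (Module.finrank K L).Prime) : IsAbelianGalois K L := by
  rw [← IsGalois.card_aut_eq_finrank] at h
  have : IsCyclic Gal(L/K) := by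
    rcases h with h | h
    · have : Subsingleton Gal(L/K) := (Nat.card_eq_one_iff_unique.1 h).1
      infer_instance
    · have := Fact.mk h
      exact isCyclic_of_prime_card rfl
  exact IsAbelianGalois.of_isCyclic K L

/-- The cubic polynomial `X³ - 3 c₄ X - 2 c₆`. -/
noncomputable def twoDivPoly (c₄ c₆ : K) : Polynomial K :=
  Polynomial.X ^ 3 - Polynomial.C (3 * c₄) * Polynomial.X - Polynomial.C (2 * c₆)

theorem twoDivPoly_monic (c₄ c₆ : K) : (twoDivPoly c₄ c₆).Monic := by
  unfold twoDivPoly; monicity!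

theorem twoDivPoly_natDegree (c₄ c₆ : K) : (twoDivPoly c₄ c₆).natDegree = 3 := by
  unfold twoDivPoly; compute_degree!

theorem aeval_twoDivPoly {Ω : Type*} [Field Ω] [Algebra K Ω] (c₄ c₆ : K) (x : Ω) :
    Polynomial.aeval x (twoDivPoly c₄ c₆) =
      twoDiv (algebraMap K Ω c₄) (algebraMap K Ω c₆) x := by
  simp only [twoDivPoly, twoDiv, map_sub, map_mul, map_pow, Polynomial.aeval_X, Polynomial.aeval_C,
    map_ofNat]

variable (K) in
/-- The splitting field of the two-division polynomial. -/
noncomputable def twoDivField (c₄ c₆ : K) : IntermediateField K (AlgebraicClosure K) :=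
  adjoin K {X | twoDiv (algebraMap K (AlgebraicClosure K) c₄)
    (algebraMap K (AlgebraicClosure K) c₆) X = 0}

variable (c₄ c₆ : K)

local notation "Ω" => AlgebraicClosure K

theorem twoDivField_eq : twoDivField K c₄ c₆ = adjoin K ((twoDivPoly c₄ c₆).rootSet Ω) := by
  unfold twoDivField
  congr 1
  ext X
  rw [Polynomial.mem_rootSet, aeval_twoDivPoly]
  exact ⟨fun h => ⟨(twoDivPoly_monic c₄ c₆).ne_zero, h⟩, fun h => h.2⟩

variable [CharZero K]

instance isSplittingField_twoDivField :
    (twoDivPoly c₄ c₆).IsSplittingField K (twoDivField K c₄ c₆) := by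
  rw [twoDivField_eq]
  exact adjoin_rootSet_isSplittingField (IsAlgClosed.splits _)

instance finiteDimensional_twoDivField : FiniteDimensional K (twoDivField K c₄ c₆) :=
  Polynomial.IsSplittingField.finiteDimensional _ (twoDivPoly c₄ c₆)

instance normal_twoDivField : Normal K (twoDivField K c₄ c₆) :=
  Normal.of_isSplittingField (twoDivPoly c₄ c₆)

/-- The Galois group acts faithfully on at most three roots. -/
theorem finrank_twoDivField_dvd_six : Module.finrank K (twoDivField K c₄ c₆) ∣ 6 := by
  set p := twoDivPoly c₄ c₆
  have e : twoDivField K c₄ c₆ ≃ₐ[K] p.SplittingField :=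
    Polynomial.IsSplittingField.algEquiv (twoDivField K c₄ c₆) p
  have : IsGalois K p.SplittingField := ⟨⟩
  have : Fact ((p.map (algebraMap K Ω)).Splits) := ⟨IsAlgClosed.splits _⟩
  rw [e.toLinearEquiv.finrank_eq, ← IsGalois.card_aut_eq_finrank]
  refine (Subgroup.card_dvd_of_injective _ (Polynomial.Gal.galActionHom_injective p Ω)).trans ?_
  rw [Nat.card_perm]
  refine Nat.factorial_dvd_factorial (n := 3) ?_
  rw [Nat.card_coe_set_eq]
  exact (Polynomial.ncard_rootSet_le p Ω).trans (twoDivPoly_natDegree c₄ c₆).le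

theorem finrank_twoDivField_le_two {x : K} (hx : twoDiv c₄ c₆ x = 0) :
    Module.finrank K (twoDivField K c₄ c₆) ≤ 2 := by
  have hx' := congrArg (algebraMap K Ω) hx
  rw [← twoDiv_algebraMap, map_zero] at hx'
  -- The radicand is the discriminant of the cofactor X² + xX + (x² - 3c₄), one root of which
  -- generates the splitting field.
  obtain ⟨s, hs⟩ := IsAlgClosed.exists_pow_nat_eq
    (algebraMap K Ω (x ^ 2 - 4 * (x ^ 2 - 3 * c₄))) two_pos
  rw [map_sub, map_mul, map_sub, map_mul, map_pow, map_ofNat, map_ofNat] at hs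
  set θ := (-algebraMap K Ω x + s) / 2 with hθ
  set x' := algebraMap K Ω x
  have hθ2 : θ ^ 2 + x' * θ + (x' ^ 2 - 3 * algebraMap K Ω c₄) = 0 := by
    rw [hθ]
    linear_combination hs / 4
  have hle : twoDivField K c₄ c₆ ≤ K⟮θ⟯ := by
    refine adjoin_le_iff.2 fun X (hX : _ = _) => ?_
    have hx'm : x' ∈ K⟮θ⟯ := IntermediateField.algebraMap_mem _ x
    have hθm := mem_adjoin_simple_self K θ
    have : (X - x') * ((X - θ) * (X + x' + θ)) = 0 := by
      rw [twoDiv] at hX hx'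
      linear_combination hX - hx' - (X - x') * hθ2
    rcases mul_eq_zero.1 this with h | h
    · rwa [SetLike.mem_coe, sub_eq_zero.1 h]
    rcases mul_eq_zero.1 h with h | h
    · rwa [SetLike.mem_coe, sub_eq_zero.1 h]
    · rw [SetLike.mem_coe, show X = -x' - θ by linear_combination h]
      exact sub_mem (neg_mem hx'm) hθm
  have hint : IsIntegral K θ := Algebra.IsIntegral.isIntegral θ
  have := adjoin.finiteDimensional hint
  have hfin := finrank_le_of_le_right hle
  exact hfin.trans (finrank_adjoin_simple_le_two x (x ^ 2 - 3 * c₄) (by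
    rw [map_sub, map_mul, map_pow, map_ofNat]
    exact hθ2))

/-- If the intersection of the splitting field of a cubic with a normal extension `L` is not
abelian, then the cubic has no root in the base field and its splitting field is contained
in `L`. -/
theorem le_and_ne_zero_of_not_isAbelianGalois (L : IntermediateField K Ω) [Normal K L]
    (h : ¬ IsAbelianGalois K (twoDivField K c₄ c₆ ⊓ L : IntermediateField K Ω)) :
    twoDivField K c₄ c₆ ≤ L ∧ ∀ x : K, twoDiv c₄ c₆ x ≠ 0 := by
  set M : IntermediateField K Ω := twoDivField K c₄ c₆ ⊓ L
  have hM : M ≤ twoDivField K c₄ c₆ := inf_le_left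
  have : FiniteDimensional K M := Module.Finite.of_injective (inclusion hM).toLinearMap (inclusion_injective hM)
  have : IsGalois K M := ⟨⟩
  have hdvd : Module.finrank K M ∣ Module.finrank K (twoDivField K c₄ c₆) :=
    finrank_dvd_of_le_right hM
  have hdvd6 := finrank_twoDivField_dvd_six c₄ c₆
  -- The other divisors 1, 2, 3 of 6 give trivial or prime order, hence abelian, groups.
  have h6 : Module.finrank K M = 6 := by
    by_contra h6
    refine h (isAbelianGalois_of_finrank_prime_or_one ?_)
    have hd := hdvd.trans hdvd6
    have hle := Nat.le_of_dvd (by norm_num) hd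
    interval_cases hn : Module.finrank K M
    · simp at hd
    · exact Or.inl rfl
    · exact Or.inr Nat.prime_two
    · exact Or.inr Nat.prime_three
    · omega
    · omega
    · omega
  have h6' : Module.finrank K (twoDivField K c₄ c₆) = 6 :=
    Nat.dvd_antisymm hdvd6 (h6 ▸ hdvd)
  refine ⟨?_, fun x hx => ?_⟩
  · have : M = twoDivField K c₄ c₆ := eq_of_le_of_finrank_eq hM (h6.trans h6'.symm)
    rw [← this]
    exact inf_le_right
  · have := finrank_twoDivField_le_two c₄ c₆ hx
    omega

variable {c₄ c₆} in
/-- An irreducible cubic whose discriminant is `-3` times a square, with `-3` not a square, has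
non-abelian splitting field. -/
theorem not_isAbelianGalois_twoDivField {w : K}
    (hrel : (c₄ ^ 3 - c₆ ^ 2) * w ^ 2 = -3 * 1728 * 48 ^ 2)
    (hirr : ∀ x : K, twoDiv c₄ c₆ x ≠ 0) (h3 : ∀ s : K, s ^ 2 ≠ -3) :
    ¬ IsAbelianGalois K (twoDivField K c₄ c₆) := by
  intro hab
  set p := twoDivPoly c₄ c₆ with hp
  have hpirr : Irreducible p := by
    refine Polynomial.irreducible_of_degree_le_three_of_not_isRoot ?_ fun x hx => hirr x ?_
    · rw [hp, twoDivPoly_natDegree]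
      decide
    · have h := aeval_twoDivPoly c₄ c₆ x
      rwa [Polynomial.coe_aeval_eq_eval, ← hp, hx.eq_zero, eq_comm] at h
  obtain ⟨e, he⟩ : ∃ e : Ω, Polynomial.aeval e p = 0 :=
    IsAlgClosed.exists_aeval_eq_zero _ p hpirr.degree_pos.ne'
  have hmin : minpoly K e = p := (minpoly.eq_of_irreducible_of_monic hpirr he
    (twoDivPoly_monic c₄ c₆)).symm
  have hint : IsIntegral K e := Algebra.IsIntegral.isIntegral e
  have := adjoin.finiteDimensional hint
  have hfin : Module.finrank K K⟮e⟯ = 3 := by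
    rw [adjoin.finrank hint, hmin, hp, twoDivPoly_natDegree]
  rw [hp, aeval_twoDivPoly] at he
  have hle : K⟮e⟯ ≤ twoDivField K c₄ c₆ := adjoin_simple_le_iff.2 (subset_adjoin _ _ he)
  have : IsAbelianGalois K K⟮e⟯ := IsAbelianGalois.of_algHom (inclusion hle)
  -- In an abelian extension every subextension is normal, so the cubic field K(e) contains all the
  -- roots.
  have hroots (X : Ω) (hX : twoDiv (algebraMap K Ω c₄) (algebraMap K Ω c₆) X = 0) : X ∈ K⟮e⟯ := by
    have hsplit := Normal.splits (inferInstance : Normal K K⟮e⟯) (AdjoinSimple.gen K e)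
    rw [minpoly_gen, hmin, splits_iff_mem (IsAlgClosed.splits _)] at hsplit
    refine hsplit X (Polynomial.mem_rootSet.2 ⟨hpirr.ne_zero, ?_⟩)
    rw [hp, aeval_twoDivPoly, hX]
  set C₄ := algebraMap K Ω c₄
  set C₆ := algebraMap K Ω c₆
  have hrel' := congrArg (algebraMap K Ω) hrel
  simp only [map_mul, map_sub, map_pow, map_neg, map_ofNat] at hrel'
  set W := algebraMap K Ω w
  obtain ⟨d, hd⟩ := IsAlgClosed.exists_pow_nat_eq (e ^ 2 - 4 * (e ^ 2 - 3 * C₄)) two_pos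
  have he2 := hroots ((-e + d) / 2) (by
    rw [twoDiv] at he ⊢
    linear_combination he + (d - 3 * e) / 8 * hd)
  have hem := mem_adjoin_simple_self K e
  have hdm : d ∈ K⟮e⟯ := by
    rw [show d = 2 * ((-e + d) / 2) + e by ring]
    exact add_mem (mul_mem (ofNat_mem _ 2) he2) hem
  -- Here d is the difference of the other two roots and 3e² - 3c₄ the derivative at e, so their
  -- product is a square root of the discriminant 108(c₄³ - c₆²). The factor W/20736 scales it to a
  -- square root of -3, which a cubic field cannot contain unless K does.
  set s := d * (3 * e ^ 2 - 3 * C₄) * W / 20736 with hs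
  have hsm : s ∈ K⟮e⟯ := by
    have hC₄ : C₄ ∈ K⟮e⟯ := IntermediateField.algebraMap_mem _ _
    have hW : W ∈ K⟮e⟯ := IntermediateField.algebraMap_mem _ _
    exact div_mem (mul_mem (mul_mem hdm (sub_mem (mul_mem (ofNat_mem _ 3) (pow_mem hem 2))
      (mul_mem (ofNat_mem _ 3) hC₄))) hW) (ofNat_mem _ 20736)
  have hs2 : s ^ 2 = -3 := by
    rw [twoDiv] at he
    rw [hs]
    linear_combination (3 * e ^ 2 - 3 * C₄) ^ 2 * W ^ 2 / 20736 ^ 2 * hd + 108 / 20736 ^ 2 * hrel' -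
      27 * (e ^ 3 - 3 * C₄ * e + 2 * C₆) * W ^ 2 / 20736 ^ 2 * he
  have hsK := finrank_adjoin_simple_le_two (K := K) (θ := s) 0 3 (by
    rw [hs2, map_zero, map_ofNat]; ring)
  have hsdvd : Module.finrank K K⟮s⟯ ∣ 3 := by
    rw [← hfin]
    exact finrank_dvd_of_le_right (adjoin_simple_le_iff.2 hsm)
  have hs1 : Module.finrank K K⟮s⟯ = 1 := by
    rcases (Nat.dvd_prime Nat.prime_three).1 hsdvd with h | h
    · exact h
    · omega
  obtain ⟨r, hr⟩ := IntermediateField.mem_bot.1 (finrank_adjoin_simple_eq_one_iff.1 hs1)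
  refine h3 r ((algebraMap K Ω).injective ?_)
  rw [map_pow, hr, hs2, map_neg, map_ofNat]

end CubicFields

/-! ### The 2- and 3-division fields in terms of c₄ and c₆ -/

section DivisionFields

open IntermediateField WeierstrassCurve.Affine

theorem equation_iff_twoDiv {F : Type*} [Field F] [CharZero F] (W : WeierstrassCurve.Affine F)
    (x y : F) : W.Equation x y ↔
      3 * (12 * (2 * y + W.a₁ * x + W.a₃)) ^ 2 = twoDiv W.c₄ W.c₆ (12 * x + W.b₂) := by
  rw [equation_iff, twoDiv]
  simp only [WeierstrassCurve.b₂, WeierstrassCurve.b₄, WeierstrassCurve.b₆,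
    WeierstrassCurve.c₄, WeierstrassCurve.c₆]
  constructor <;> intro h
  · linear_combination 1728 * h
  · linear_combination h / 1728

theorem threeDiv_eq {F : Type*} [Field F] (W : WeierstrassCurve F) (x : F) :
    threeDiv W.c₄ W.c₆ (12 * x + W.b₂) =
      6912 * (3 * x ^ 4 + W.b₂ * x ^ 3 + 3 * W.b₄ * x ^ 2 + 3 * W.b₆ * x + W.b₈) := by
  simp only [threeDiv, WeierstrassCurve.b₂, WeierstrassCurve.b₄, WeierstrassCurve.b₆,
    WeierstrassCurve.b₈, WeierstrassCurve.c₄, WeierstrassCurve.c₆]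
  ring

theorem j_mul_Δ {R : Type*} [CommRing R] (E : WeierstrassCurve R) [E.IsElliptic] :
    E.j * E.Δ = E.c₄ ^ 3 := by
  rw [WeierstrassCurve.j, mul_right_comm, ← E.coe_Δ', Units.inv_mul, one_mul]

variable {K : Type*} [Field K] [CharZero K] (E : WeierstrassCurve K)

/-- Automorphisms over K act on the points by group homomorphisms, so they permute the n-torsion. -/
instance normal_divisionField (n : ℕ) : Normal K (divisionField E n) := by
  classical
  rw [normal_iff_forall_map_le]
  intro σ
  rw [divisionField, adjoin_map]
  refine adjoin.mono _ _ _ ?_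
  rintro _ ⟨z, ⟨x, y, hxy, hn, hz⟩, rfl⟩
  have h : n • Point.map (W' := E) σ (.some x y hxy) = 0 :=
    (map_nsmul (Point.map (W' := E) σ) n _).symm.trans (congrArg (Point.map (W' := E) σ) hn)
  refine ⟨σ x, σ y, _, h, ?_⟩
  rcases hz with rfl | rfl
  · exact Or.inl rfl
  · exact Or.inr rfl

variable [E.IsElliptic]

theorem divisionField_two : divisionField E 2 = twoDivField K E.c₄ E.c₆ := by
  classical
  have : CharZero (AlgebraicClosure K) := charZero_of_injective_algebraMap
    (algebraMap K (AlgebraicClosure K)).injective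
  unfold divisionField
  set W := (E.map (algebraMap K (AlgebraicClosure K))).toAffine with hW
  have : W.IsElliptic := inferInstanceAs
    (E.map (algebraMap K (AlgebraicClosure K))).IsElliptic
  have h₁ : W.a₁ = algebraMap K _ E.a₁ := rfl
  have h₃ : W.a₃ = algebraMap K _ E.a₃ := rfl
  have hb : W.b₂ = algebraMap K _ E.b₂ := E.map_b₂ _
  have hc₄ : W.c₄ = algebraMap K _ E.c₄ := E.map_c₄ _
  have hc₆ : W.c₆ = algebraMap K _ E.c₆ := E.map_c₆ _
  apply le_antisymm
  · refine adjoin_le_iff.2 ?_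
    rintro z ⟨x, y, hxy, h2, hz⟩
    rw [two_nsmul_some_eq_zero_iff] at h2
    have heq := (equation_iff_twoDiv W x y).1 hxy.1
    rw [h2, hc₄, hc₆, hb] at heq
    have hX : 12 * x + algebraMap K _ E.b₂ ∈ twoDivField K E.c₄ E.c₆ :=
      subset_adjoin _ _ (by rw [Set.mem_ofPred_eq, ← heq]; ring)
    have hx : x ∈ twoDivField K E.c₄ E.c₆ := by
      rw [show x = (12 * x + algebraMap K _ E.b₂ - algebraMap K _ E.b₂) / 12 by ring]
      exact div_mem (sub_mem hX (IntermediateField.algebraMap_mem _ _)) (ofNat_mem _ 12)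
    rcases hz with rfl | rfl
    · exact hx
    · rw [h₁, h₃] at h2
      rw [SetLike.mem_coe, show z = -(algebraMap K _ E.a₁ * x + algebraMap K _ E.a₃) / 2 by
        linear_combination h2 / 2]
      exact div_mem (neg_mem (add_mem (mul_mem (IntermediateField.algebraMap_mem _ _) hx)
        (IntermediateField.algebraMap_mem _ _))) (ofNat_mem _ 2)
  · refine adjoin_le_iff.2 fun X (hX : _ = _) => ?_
    set x := (X - W.b₂) / 12 with hx
    have hXx : X = 12 * x + W.b₂ := by rw [hx]; ring
    set y := -(W.a₁ * x + W.a₃) / 2 with hy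
    have hη : 2 * y + W.a₁ * x + W.a₃ = 0 := by rw [hy]; ring
    have hns : W.Nonsingular x y := by
      rw [← equation_iff_nonsingular, equation_iff_twoDiv, hη, ← hXx, hc₄, hc₆, hX]
      ring
    rw [SetLike.mem_coe, hXx]
    refine add_mem (mul_mem (ofNat_mem _ 12) (subset_adjoin _ _ ?_)) ?_
    · exact ⟨x, y, hns, (two_nsmul_some_eq_zero_iff W hns).2 hη, Or.inl rfl⟩
    · rw [hb]
      exact IntermediateField.algebraMap_mem _ _

theorem mem_divisionField_three {X : AlgebraicClosure K}
    (hX : threeDiv (algebraMap K _ E.c₄) (algebraMap K _ E.c₆) X = 0) :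
    X ∈ divisionField E 3 := by
  classical
  have : CharZero (AlgebraicClosure K) := charZero_of_injective_algebraMap
    (algebraMap K (AlgebraicClosure K)).injective
  unfold divisionField
  set W := (E.map (algebraMap K (AlgebraicClosure K))).toAffine with hW
  have : W.IsElliptic := inferInstanceAs
    (E.map (algebraMap K (AlgebraicClosure K))).IsElliptic
  have hb : W.b₂ = algebraMap K _ E.b₂ := E.map_b₂ _
  have hc₄ : W.c₄ = algebraMap K _ E.c₄ := E.map_c₄ _
  have hc₆ : W.c₆ = algebraMap K _ E.c₆ := E.map_c₆ _
  set x := (X - W.b₂) / 12 with hx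
  have hXx : X = 12 * x + W.b₂ := by rw [hx]; ring
  -- s is to be 2y + a₁x + a₃; the constant is 432 = 3 · 12².
  obtain ⟨s, hs⟩ := IsAlgClosed.exists_pow_nat_eq (twoDiv W.c₄ W.c₆ X / 432) two_pos
  set y := (s - W.a₁ * x - W.a₃) / 2 with hy
  have hns : W.Nonsingular x y := by
    rw [← equation_iff_nonsingular, equation_iff_twoDiv, ← hXx,
      show 2 * y + W.a₁ * x + W.a₃ = s by rw [hy]; ring]
    linear_combination 432 * hs
  have h3 : 3 • Point.some x y hns = 0 := by
    rw [three_nsmul_some_eq_zero_iff]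
    rw [← hc₄, ← hc₆, hXx, threeDiv_eq] at hX
    exact (mul_eq_zero.1 hX).resolve_left (by norm_num)
  rw [hXx]
  refine add_mem (mul_mem (ofNat_mem _ 12) (subset_adjoin _ _ ?_)) ?_
  · exact ⟨x, y, hns, h3, Or.inl rfl⟩
  · rw [hb]
    exact IntermediateField.algebraMap_mem _ _

omit [E.IsElliptic] in
theorem divisionField_three_le {N : IntermediateField K (AlgebraicClosure K)}
    (hN : ∀ X, threeDiv (algebraMap K _ E.c₄) (algebraMap K _ E.c₆) X = 0 → X ∈ N ∧
      ∀ Y, 3 * Y ^ 2 = twoDiv (algebraMap K _ E.c₄) (algebraMap K _ E.c₆) X → Y ∈ N) :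
    divisionField E 3 ≤ N := by
  classical
  have : CharZero (AlgebraicClosure K) := charZero_of_injective_algebraMap
    (algebraMap K (AlgebraicClosure K)).injective
  unfold divisionField
  set W := (E.map (algebraMap K (AlgebraicClosure K))).toAffine with hW
  have h₁ : W.a₁ = algebraMap K _ E.a₁ := rfl
  have h₃ : W.a₃ = algebraMap K _ E.a₃ := rfl
  have hb : W.b₂ = algebraMap K _ E.b₂ := E.map_b₂ _
  have hc₄ : W.c₄ = algebraMap K _ E.c₄ := E.map_c₄ _
  have hc₆ : W.c₆ = algebraMap K _ E.c₆ := E.map_c₆ _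
  refine adjoin_le_iff.2 ?_
  rintro z ⟨x, y, hxy, h3, hz⟩
  rw [three_nsmul_some_eq_zero_iff] at h3
  have h3' := threeDiv_eq W x
  rw [h3, mul_zero, hc₄, hc₆, hb] at h3'
  have heq := (equation_iff_twoDiv W x y).1 hxy.1
  rw [hc₄, hc₆, hb] at heq
  obtain ⟨hX, hY⟩ := hN _ h3'
  have hx : x ∈ N := by
    rw [show x = (12 * x + algebraMap K _ E.b₂ - algebraMap K _ E.b₂) / 12 by ring]
    exact div_mem (sub_mem hX (IntermediateField.algebraMap_mem _ _)) (ofNat_mem _ 12)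
  rcases hz with rfl | rfl
  · exact hx
  · have hYm := hY _ heq
    rw [h₁, h₃] at hYm
    rw [SetLike.mem_coe, show z = (12 * (2 * z + algebraMap K _ E.a₁ * x + algebraMap K _ E.a₃) / 12
      - algebraMap K _ E.a₁ * x - algebraMap K _ E.a₃) / 2 by ring]
    exact div_mem (sub_mem (sub_mem (div_mem hYm (ofNat_mem _ 12))
      (mul_mem (IntermediateField.algebraMap_mem _ _) hx)) (IntermediateField.algebraMap_mem _ _))
      (ofNat_mem _ 2)

end DivisionFields

/-! ### The two directions of the classification -/

open IntermediateField in
/-- A curve with non-abelian `(2, 3)`-entanglement is parametrised by the Brau–Jones family, and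
its two-division polynomial has no rational root. -/
theorem exists_param_of_hasNonabelianEntanglement {K : Type*} [Field K] [CharZero K]
    (E : WeierstrassCurve K) [E.IsElliptic] (h : HasNonabelianEntanglement E 2 3) :
    (∀ x : K, twoDiv E.c₄ E.c₆ x ≠ 0) ∧
      ∃ t : K, E.j = 2 ^ 10 * 3 ^ 3 * t ^ 3 * (1 - 4 * t ^ 3) := by
  have hchar : CharZero (AlgebraicClosure K) := charZero_of_injective_algebraMap
    (algebraMap K (AlgebraicClosure K)).injective
  unfold HasNonabelianEntanglement entanglementField at h
  rw [divisionField_two] at h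
  obtain ⟨hle, hirr⟩ := le_and_ne_zero_of_not_isAbelianGalois E.c₄ E.c₆ (divisionField E 3) h
  refine ⟨hirr, ?_⟩
  have hΔ0 : E.Δ ≠ 0 := E.isUnit_Δ.ne_zero
  obtain ⟨δ, hδ⟩ := IsAlgClosed.exists_pow_nat_eq (algebraMap K (AlgebraicClosure K) E.Δ) three_pos
  obtain ⟨N, hN, hmem⟩ := exists_sqrtTower E.c₄ E.c₆ (δ := δ) (by
    rw [hδ, ← map_pow, ← map_pow, ← map_sub, ← E.c_relation, map_mul, map_ofNat])
  obtain ⟨e, he⟩ : ∃ e : AlgebraicClosure K, Polynomial.aeval e (twoDivPoly E.c₄ E.c₆) = 0 :=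
    IsAlgClosed.exists_aeval_eq_zero _ _ (by
      rw [Polynomial.degree_eq_natDegree (twoDivPoly_monic _ _).ne_zero, twoDivPoly_natDegree]
      decide)
  rw [aeval_twoDivPoly] at he
  have heN : e ∈ N := divisionField_three_le E hmem (hle (subset_adjoin _ _ he))
  obtain ⟨θ, hθ, hfθ⟩ := hN.exists_root (p := -3 * algebraMap K _ E.c₄)
    (q := -2 * algebraMap K _ E.c₆)
    (mul_mem (neg_mem (ofNat_mem _ 3)) (IntermediateField.algebraMap_mem _ _))
    (mul_mem (neg_mem (ofNat_mem _ 2)) (IntermediateField.algebraMap_mem _ _)) heN (by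
      rw [twoDiv] at he
      linear_combination he)
  obtain ⟨t, ht⟩ := exists_param_of_root_mem_adjoin_cubeRoot hΔ0 E.c_relation hirr hδ hθ (by
    rw [twoDiv]
    linear_combination hfθ)
  refine ⟨t, mul_right_cancel₀ hΔ0 ?_⟩
  rw [j_mul_Δ, ht]
  ring

-- Every 2-torsion abscissa is a polynomial in some cube root of Δ, and all of these lie in ℚ(E[3]).
-- So the entanglement field is the whole of ℚ(E[2]).
open IntermediateField in
theorem hasNonabelianEntanglement_of_param (E : WeierstrassCurve ℚ) [E.IsElliptic] {t : ℚ}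
    (ht0 : t ≠ 0) (ht1 : t ≠ 1 / 2) (hj : E.j = 2 ^ 10 * 3 ^ 3 * t ^ 3 * (1 - 4 * t ^ 3)) :
    HasNonabelianEntanglement E 2 3 := by
  have hΔ0 : E.Δ ≠ 0 := E.isUnit_Δ.ne_zero
  have hj' : E.c₄ ^ 3 = E.Δ * (2 ^ 10 * 3 ^ 3 * t ^ 3 * (1 - 4 * t ^ 3)) := by
    rw [← j_mul_Δ, hj]
    ring
  have hirr := twoDiv_ne_zero_of_param hΔ0 E.c_relation ht0 ht1 hj'
  obtain ⟨a, b, w, -, -, hΔw, h₄, h₆, -⟩ := exists_coeffs_of_param hΔ0 E.c_relation ht0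
    (eight_mul_cube_ne_one ht1) hj'
  have hle : divisionField E 2 ≤ divisionField E 3 := by
    rw [divisionField_two]
    refine adjoin_le_iff.2 fun X hX => ?_
    obtain ⟨δ, hδ, rfl⟩ := exists_cubeRoot_of_twoDiv_eq_zero h₄ h₆ hX
    have hδm : δ ∈ divisionField E 3 :=
      cubeRoot_mem (IntermediateField.algebraMap_mem _ _) (fun X => mem_divisionField_three E) (by
        rw [hδ, ← map_pow, ← map_pow, ← map_sub, ← E.c_relation, map_mul, map_ofNat])
    exact add_mem (mul_mem (IntermediateField.algebraMap_mem _ _) hδm)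
      (mul_mem (IntermediateField.algebraMap_mem _ _) (pow_mem hδm 2))
  unfold HasNonabelianEntanglement entanglementField
  rw [inf_eq_left.2 hle, divisionField_two]
  refine not_isAbelianGalois_twoDivField (w := w) ?_ hirr fun s hs => ?_
  · linear_combination 1728 * hΔw - w ^ 2 * E.c_relation
  · nlinarith [sq_nonneg s]

end Entanglement

theorem mainTheorem6 (E : WeierstrassCurve ℚ) [E.IsElliptic] (hE : ¬ Entanglement.HasCM E) :
    Entanglement.HasNonabelianEntanglement E 2 3 ↔
      E.j ∈ Entanglement.brauJonesFamily ∪ Entanglement.borelEntanglementFamily := by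
  have hΔ0 : E.Δ ≠ 0 := E.isUnit_Δ.ne_zero
  -- The absence of CM enters only here, to exclude j = 0.
  have hj0 : E.j ≠ 0 := fun hj => hE (Entanglement.hasCM_of_c₄_eq_zero E (by
    have := Entanglement.j_mul_Δ E
    rw [hj, zero_mul] at this
    exact pow_eq_zero_iff three_ne_zero |>.1 this.symm))
  constructor
  · intro h
    obtain ⟨hirr, t, ht⟩ := Entanglement.exists_param_of_hasNonabelianEntanglement E h
    refine Or.inl ⟨t, ?_, ?_, ht⟩
    · rintro rfl
      exact hj0 (by rw [ht]; ring)
    -- At t = 1/2, j = 1728 and c₆ = 0, so 0 is a rational root of the 2-division cubic.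
    · rintro rfl
      have h6 : E.c₆ ^ 2 = 0 := by
        have h1 := Entanglement.j_mul_Δ E
        rw [ht] at h1
        linear_combination E.c_relation - h1
      have h6 := pow_eq_zero_iff two_ne_zero |>.1 h6
      exact hirr 0 (by rw [Entanglement.twoDiv, h6]; ring)
  · rintro (⟨t, ht0, ht1, hj⟩ | ⟨s, t, ht, hj, hj'⟩)
    · exact Entanglement.hasNonabelianEntanglement_of_param E ht0 ht1 hj
    · refine Entanglement.hasNonabelianEntanglement_of_param E (t := s) ?_ ?_ hj
      · rintro rfl
        exact hj0 (by rw [hj]; ring)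
      -- At s = 1/2, j = 1728, and (t + 1)(t + 9)³ - 64t³ = (t² - 18t - 27)² has the irrational
      -- roots 9 ± 6√3.
      · rintro rfl
        have h0 : (t ^ 2 - 18 * t - 27) ^ 2 = 0 := by
          rw [hj] at hj'
          field_simp at hj'
          linear_combination -hj' / 27
        have h1 : (t - 9) ^ 2 = 108 := by
          have := pow_eq_zero_iff two_ne_zero |>.1 h0
          linear_combination this
        have h2 : IsSquare (3 : ℚ) := ⟨(t - 9) / 6, by linear_combination -h1 / 36⟩
        rw [show (3 : ℚ) = ((3 : ℕ) : ℚ) by norm_num, Rat.isSquare_natCast_iff] at h2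
        exact Nat.prime_three.prime.not_isSquare h2
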